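/- \textbf{Setting.} Let $A\in\mathbb{R}^{d_x\times d_x}$ be stable, i.e. its spectral radius satisfies $\rho(A)<1$, and let $(x_i)_{i\ge 0}$ be given by $x_0=0$ and $x_{i+1}=Ax_i+\eta_i$ for $i\ge 0$. The noise vectors $(\eta_i)_{i\ge 0}$ are i.i.d. and zero-mean; they are $\sigma^2$-subgaussian, i.e. $\mathbb{E}\,e^{t\langle u,\eta_0\rangle}\le e^{\sigma^2t^2/2}$ for all $t\in\mathbb{R}$ and all unit vectors $u$; and their covariance satisfies $\mathbb{E}[\eta_0\eta_0^\top]\succeq I_{d_x}$ (for instance isotropic noise, $\mathbb{E}[\eta_0\eta_0^\top]=I_{d_x}$). Let $X,Y\in\mathbb{R}^{n\times d_x}$ be the matrices with rows $x_1,\dots,x_n$ and $y_1,\dots,y_n$, where $y_i=x_{i+1}$. For $1\le r\le d_x$, the estimator R-LSE is $\hat A_n=\Pi_r(\bar A_n)$, where $\bar A_n$ is a least-squares estimate, i.e. a minimizer of $B\mapsto\|Y-XB^\top\|_F^2$ (equal to $Y^\top X(X^\top X)^{-1}$ if $X^\top X$ is invertible), and $\Pi_r(M)=\sum_{i\le r}s_iu_iv_i^\top$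 is the rank-$r$ truncation of a singular value decomposition $M=\sum_i s_iu_iv_i^\top$, $s_1\ge s_2\ge\dots\ge 0$. Minimizers, and singular vectors in case of ties, may be selected arbitrarily. Let $\Gamma_\infty(A)=\sum_{k\ge0}A^k(A^k)^\top$. Let $\|\cdot\|_2$ be the spectral norm and $\|\cdot\|_F$ the Frobenius norm. For a symmetric positive definite matrix $\Gamma\in\mathbb{R}^{d_x\times d_x}$ with eigenvalues $\lambda_1\ge\dots\ge\lambda_{d_x}=\lambda_{\min}(\Gamma)$, let $$\underline{\lambda}^H_r(\Gamma)=\Big(\frac1r\sum_{i=d_x-r+1}^{d_x}\frac1{\lambda_i}\Big)^{-1}$$ be the harmonic mean of the $r$ smallest eigenvalues. \textbf{Theorem.} There are universal constants $c,C>0$ such that the following holds. Let $\delta\in(0,1)$, $1\le r\le d_x$, $\mathrm{rank}(A)\le r$, and let $n$ satisfy the burn-in condition $$n\ \ge\ \frac{c\,\sigma^4\,\|\Gamma_\infty(A)\|_2^3}{\lambda_{\min}(\Gamma_\infty(A))}\Big(d_x+\log\frac1\delta\Big).$$ Then, with probability at least $1-\delta$, $$\|\hat A_n-A\|_F^2\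 \le\ C\,\frac{r\,\sigma^2\,\big(d_x+\log\frac1\delta\big)}{n\,\underline{\lambda}^H_r(\Gamma_\infty(A))}.$$ -/

import Mathlib

open MeasureTheory ProbabilityTheory
open scoped NNReal ENNReal Matrix

/-- The Frobenius norm of a real matrix. -/
noncomputable def frobNorm {m n : ℕ} (M : Matrix (Fin m) (Fin n) ℝ) : ℝ :=
  (Matrix.frobeniusNormedAddCommGroup (m := Fin m) (n := Fin n) (α := ℝ)).norm M

/-- The spectral norm (the `ℓ² → ℓ²` operator norm) of a real matrix. -/
noncomputable def opNorm {m n : ℕ} (M : Matrix (Fin m) (Fin n) ℝ) : ℝ :=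
  (Matrix.instL2OpNormedAddCommGroup (m := Fin m) (n := Fin n) (𝕜 := ℝ)).norm M

/-- A real square matrix is (Schur) stable if its (complex) spectral radius is smaller than one. -/
def IsSchurStable {d : ℕ} (A : Matrix (Fin d) (Fin d) ℝ) : Prop :=
  spectralRadius ℂ (A.map (algebraMap ℝ ℂ)) < 1

/-- The infinite-horizon controllability Gramian `Γ_∞(A) = ∑_{k ≥ 0} A^k (A^k)ᵀ`
(the series converges when `A` is stable). -/
noncomputable def gramianInf {d : ℕ} (A : Matrix (Fin d) (Fin d) ℝ) :
    Matrix (Fin d) (Fin d) ℝ :=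
  ∑' k : ℕ, A ^ k * (A ^ k)ᵀ

theorem gramianInf_isHermitian {d : ℕ} (A : Matrix (Fin d) (Fin d) ℝ) :
    (gramianInf A).IsHermitian := by
  unfold Matrix.IsHermitian gramianInf
  rw [Matrix.conjTranspose_eq_transpose_of_trivial, Matrix.transpose_tsum]
  simp [Matrix.transpose_mul]

/-- The eigenvalues of a real symmetric matrix in nonincreasing order, with multiplicity; the index
`i : Fin d` stands for the `(i + 1)`-st largest eigenvalue. -/
noncomputable def sortedEig {d : ℕ} {M : Matrix (Fin d) (Fin d) ℝ} (hM : M.IsHermitian)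
    (i : Fin d) : ℝ :=
  hM.eigenvalues₀ (Fin.cast (Fintype.card_fin d).symm i)

/-- The smallest eigenvalue of a real symmetric matrix (of positive size). -/
noncomputable def minEig {d : ℕ} {M : Matrix (Fin d) (Fin d) ℝ} (hM : M.IsHermitian) : ℝ :=
  ⨅ i : Fin d, sortedEig hM i

/-- The harmonic mean of the `r` smallest eigenvalues of a symmetric `d × d` matrix:
`((1 / r) ∑_{i = d - r + 1}^{d} 1 / λ_i)⁻¹` with `λ_1 ≥ … ≥ λ_d`. -/
noncomputable def harmonicEig {d : ℕ} (r : ℕ) {M : Matrix (Fin d) (Fin d) ℝ}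
    (hM : M.IsHermitian) : ℝ :=
  ((1 / (r : ℝ)) * ∑ i : Fin d with d - r ≤ i.val, 1 / sortedEig hM i)⁻¹

/-- The trajectory of `x_{i+1} = A x_i + w_i`, `x_0 = 0`. -/
def ltiState {d : ℕ} (A : Matrix (Fin d) (Fin d) ℝ) (w : ℕ → Fin d → ℝ) : ℕ → Fin d → ℝ
  | 0 => 0
  | i + 1 => A *ᵥ ltiState A w i + w i

/-- The `n × d` matrix of covariates: its rows are `x_1, …, x_n`. -/
def ltiX {d : ℕ} (A : Matrix (Fin d) (Fin d) ℝ) (w : ℕ → Fin d → ℝ) (n : ℕ) :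
    Matrix (Fin n) (Fin d) ℝ :=
  Matrix.of fun i => ltiState A w ((i : ℕ) + 1)

/-- The `n × d` matrix of responses: its rows are `y_1, …, y_n`, where `y_i = x_{i+1}`. -/
def ltiY {d : ℕ} (A : Matrix (Fin d) (Fin d) ℝ) (w : ℕ → Fin d → ℝ) (n : ℕ) :
    Matrix (Fin n) (Fin d) ℝ :=
  Matrix.of fun i => ltiState A w ((i : ℕ) + 2)

/-- `B` is a least-squares estimate of `A` in `y_i = A x_i + η_i`: it minimises
`∑_i ‖y_i - B x_i‖² = ‖Y - X Bᵀ‖_F²`. -/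
def IsLeastSquares {n d : ℕ} (X Y : Matrix (Fin n) (Fin d) ℝ)
    (B : Matrix (Fin d) (Fin d) ℝ) : Prop :=
  ∀ B' : Matrix (Fin d) (Fin d) ℝ, frobNorm (Y - X * Bᵀ) ≤ frobNorm (Y - X * B'ᵀ)

/-- `B = Π_r(M)`: for some singular value decomposition `M = ∑_i s_i u_i v_iᵀ` with
`s_1 ≥ s_2 ≥ … ≥ 0` one has `B = ∑_{i ≤ r} s_i u_i v_iᵀ`. -/
def IsTruncatedSVD {d : ℕ} (r : ℕ) (M B : Matrix (Fin d) (Fin d) ℝ) : Prop :=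
  ∃ U ∈ Matrix.orthogonalGroup (Fin d) ℝ, ∃ V ∈ Matrix.orthogonalGroup (Fin d) ℝ,
    ∃ s : Fin d → ℝ, Antitone s ∧ (∀ i, 0 ≤ s i) ∧
      M = U * Matrix.diagonal s * Vᵀ ∧
      B = U * Matrix.diagonal (fun i : Fin d => if (i : ℕ) < r then s i else 0) * Vᵀ

/-- `B` is an output of the rank-constrained least-squares algorithm (R-LSE) with rank parameter
`r` on the data `(X, Y)`: the rank-`r` truncation of a least-squares estimate. -/
def IsRLSE {n d : ℕ} (r : ℕ) (X Y : Matrix (Fin n) (Fin d) ℝ)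
    (B : Matrix (Fin d) (Fin d) ℝ) : Prop :=
  ∃ Abar : Matrix (Fin d) (Fin d) ℝ, IsLeastSquares X Y Abar ∧ IsTruncatedSVD r Abar B

theorem exists_isLeastSquares {n d : ℕ} (X Y : Matrix (Fin n) (Fin d) ℝ) :
    ∃ B, IsLeastSquares X Y B := by
  let _ := Matrix.frobeniusNormedAddCommGroup (m := Fin n) (n := Fin d) (α := ℝ)
  let _ := Matrix.frobeniusNormedSpace (m := Fin n) (n := Fin d) (α := ℝ) (R := ℝ)
  have : ProperSpace (Matrix (Fin n) (Fin d) ℝ) := FiniteDimensional.proper_real _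
  let S : Submodule ℝ (Matrix (Fin n) (Fin d) ℝ) := 
    LinearMap.range (mulLeftLinearMap (Fin d) ℝ X)
  obtain ⟨y, ⟨C, rfl⟩, hy⟩ :=
    S.closed_of_finiteDimensional.exists_infDist_eq_dist ⟨0, S.zero_mem⟩ Y
  refine ⟨Cᵀ, fun B' => ?_⟩
  have h := Metric.infDist_le_dist_of_mem (x := Y) (s := (S : Set _)) (y := X * B'ᵀ) ⟨B'ᵀ, rfl⟩
  rw [hy, dist_eq_norm, dist_eq_norm] at h
  simpa [frobNorm] using h

theorem exists_isTruncatedSVD {d : ℕ} (r : ℕ) (M : Matrix (Fin d) (Fin d) ℝ) :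
    ∃ B, IsTruncatedSVD r M B := by
  suffices h : ∃ U ∈ Matrix.orthogonalGroup (Fin d) ℝ, ∃ V ∈ Matrix.orthogonalGroup (Fin d) ℝ,
      ∃ s : Fin d → ℝ, Antitone s ∧ (∀ i, 0 ≤ s i) ∧ M = U * Matrix.diagonal s * Vᵀ by
    obtain ⟨U, hU, V, hV, s, hs, h0, hM⟩ := h
    exact ⟨_, U, hU, V, hV, s, hs, h0, hM, rfl⟩
  let T := Matrix.toEuclideanLin M
  have hS := T.isSymmetric_adjoint_comp_self
  have hd : Module.finrank ℝ (EuclideanSpace ℝ (Fin d)) = d := finrank_euclideanSpace_fin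
  let v := hS.eigenvectorBasis hd
  let l := hS.eigenvalues hd
  have hl : ∀ i, 0 ≤ l i := T.isPositive_adjoint_comp_self.nonneg_eigenvalues hd
  have hin : ∀ i j, inner ℝ (T (v i)) (T (v j)) = if i = j then l j else 0 := by
    intro i j
    rw [← LinearMap.adjoint_inner_right]
    have := hS.apply_eigenvectorBasis hd j
    simp only [LinearMap.comp_apply] at this
    change inner ℝ (v i) (T.adjoint (T (hS.eigenvectorBasis hd j))) = _
    rw [this, inner_smul_right]
    have := orthonormal_iff_ite.mp v.orthonormal i j
    change _ * inner ℝ (v i) (v j) = _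
    rw [this]
    simp [l]
  let s : Fin d → ℝ := fun i => √(l i)
  have hon : Orthonormal ℝ (({i | 0 < l i} : Set (Fin d)).domRestrict fun i => (s i)⁻¹ • T (v i)) := by
    rw [orthonormal_iff_ite]
    rintro ⟨i, hi⟩ ⟨j, hj⟩
    simp only [Set.domRestrict_apply, inner_smul_left, inner_smul_right, hin]
    by_cases hij : i = j
    · subst hij
      have : s i * s i = l i := Real.mul_self_sqrt (hl i)
      have hs : s i ≠ 0 := (Real.sqrt_pos.mpr hi).ne'
      simp [← this]
      field_simp
    · simp [hij]
  obtain ⟨u, hu⟩ := hon.exists_orthonormalBasis_extension_of_card_eq (by simp)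
  have hTv : ∀ i, T (v i) = s i • u i := by
    intro i
    by_cases hi : 0 < l i
    · rw [hu i hi, smul_smul, mul_inv_cancel₀ (Real.sqrt_pos.mpr hi).ne', one_smul]
    · have h0 : l i = 0 := le_antisymm (not_lt.mp hi) (hl i)
      have := hin i i
      simp only [h0, if_true] at this
      rw [inner_self_eq_zero.mp this]
      simp [s, h0]
  let e := EuclideanSpace.basisFun (Fin d) ℝ
  refine ⟨e.toBasis.toMatrix u, e.toMatrix_orthonormalBasis_mem_unitary u,
    e.toBasis.toMatrix v, e.toMatrix_orthonormalBasis_mem_unitary v, s, ?_,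
    fun i => Real.sqrt_nonneg _, ?_⟩
  · exact fun i j hij => Real.sqrt_le_sqrt (hS.eigenvalues_antitone hd hij)
  · have hV := (Matrix.mem_orthogonalGroup_iff (Fin d) ℝ).mp
      (e.toMatrix_orthonormalBasis_mem_unitary v)
    have key : M * e.toBasis.toMatrix v = e.toBasis.toMatrix u * Matrix.diagonal s := by
      ext i j
      have h : M.mulVec (v j) i = s j * u j i := congrArg
        (fun x : EuclideanSpace ℝ (Fin d) => x i) (hTv j)
      rw [Matrix.mul_diagonal, Matrix.mul_apply]
      exact h.trans (mul_comm _ _)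
    rw [← key, Matrix.mul_assoc, hV, Matrix.mul_one]

/-- The algorithm has an output on all data. -/
theorem exists_isRLSE {n d : ℕ} (r : ℕ) (X Y : Matrix (Fin n) (Fin d) ℝ) :
    ∃ B, IsRLSE r X Y B := by
  obtain ⟨Abar, h⟩ := exists_isLeastSquares X Y
  obtain ⟨B, hB⟩ := exists_isTruncatedSVD r Abar
  exact ⟨B, Abar, h, hB⟩

/-! The proof separates a deterministic argument from concentration bounds. Write `E = Ā - A`, `D =
Â - A`, `Γ = gramianInf A`, and let `S` be the noise covariance, `G = gramian A S ⪰ Γ`, `L = d + log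
(1/δ)`.

Truncation. Since `A` has rank at most `r`, Eckart–Young gives `‖E - D‖_F ≤ ‖E‖_F`, that is `‖D‖_F²
≤ 2 tr(Eᵀ D)`. As `D` has rank at most `2r`, the trace is a sum of `2r` terms `s_i ⟨v_i, Eᵀ u_i⟩`
over singular triples of `D`. If `Γ(Eᵀ p) ≤ ε²` for all `p` in the unit ball, Cauchy–Schwarz in the
`Γ`-norm bounds each `⟨v_i, Eᵀ u_i⟩²` by `ε² v_iᵀ Γ⁻¹ v_i`. For `2r` orthonormal vectors the sum of
`v_iᵀ Γ⁻¹ v_i` is at most twice the sum of the `r` largest eigenvalues of `Γ⁻¹`, which is where the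
harmonic mean comes from. Hence `‖D‖_F² ≤ 8 ε² r / λ^H_r` (`IsTruncatedSVD.frobNorm_sub_sq_le`).

Least squares. With `z = Eᵀ p`, the normal equations read `∑ ⟨z, x_i⟩² = ∑ ⟨p, η_i⟩ ⟨z, x_i⟩`. If
the left side is at least `(n/2) G(z)` and the right side at most of order `√(n σ² L) ‖p‖ √G(z)`,
then `ε²` is of order `σ² L / n` (`IsLeastSquares.quad_error_le`).

Covariance. The moment matrix `P = ∑ x_i x_iᵀ` satisfies the Lyapunov equation of `n G` up to noise
fluctuations, cross terms and a boundary term. Stability turns `D ⪰ A D Aᵀ` into `D ⪰ 0`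
(`IsSchurStable.quad_nonneg`), so errors that are small relative to `S` yield errors that are small
relative to `G`. The cross terms form a self-normalised martingale whose size depends on `P` itself;
an upper bound on `P` is therefore improved iteratively, and the lower bound follows
(`empirical_covariance_bounds`).

Probability. Sums of centred squares are subexponential, cross terms are controlled by an
exponential supermartingale (`lintegral_exp_crossExponent_le`), and the last state is subgaussian. A
union bound over nets adapted to the forms `S`, `I` and `G` makes all bounds uniform
(`measure_not_good_event_le`). -/

/-- The quadratic form of a matrix. -/
def quad {d : ℕ} (M : Matrix (Fin d) (Fin d) ℝ) (u : Fin d → ℝ) : ℝ := u ⬝ᵥ M *ᵥ u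

/-! ### Quadratic forms. -/

section Quad

variable {d : ℕ} (M N : Matrix (Fin d) (Fin d) ℝ) (u : Fin d → ℝ)

theorem quad_add : quad (M + N) u = quad M u + quad N u := by
  simp [quad, Matrix.add_mulVec]

theorem quad_sub : quad (M - N) u = quad M u - quad N u := by
  simp [quad, Matrix.sub_mulVec]

theorem quad_smul (c : ℝ) : quad (c • M) u = c * quad M u := by
  simp [quad, Matrix.smul_mulVec]

theorem quad_smul_right (c : ℝ) : quad M (c • u) = c ^ 2 * quad M u := by
  simp [quad, Matrix.mulVec_smul]; ring

theorem quad_one : quad 1 u = u ⬝ᵥ u := by simp [quad]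

theorem quad_mul_mul_transpose : quad (M * N * Mᵀ) u = quad N (Mᵀ *ᵥ u) := by
  simp only [quad, ← Matrix.mulVec_mulVec]
  rw [Matrix.dotProduct_mulVec, ← Matrix.mulVec_transpose]

theorem quad_transpose_mul_self {m : ℕ} (R : Matrix (Fin m) (Fin d) ℝ) :
    quad (Rᵀ * R) u = (R *ᵥ u) ⬝ᵥ (R *ᵥ u) := by
  simp only [quad, ← Matrix.mulVec_mulVec]
  rw [Matrix.dotProduct_mulVec, Matrix.vecMul_transpose]

theorem dotProduct_self_nonneg' : 0 ≤ u ⬝ᵥ u := by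
  exact Finset.sum_nonneg fun i _ => mul_self_nonneg (u i)

theorem dotProduct_mulVec_comm (hM : M.IsHermitian) (v : Fin d → ℝ) :
    u ⬝ᵥ M *ᵥ v = v ⬝ᵥ M *ᵥ u := by
  have : Mᵀ = M := by simpa using hM.eq
  rw [Matrix.dotProduct_mulVec, ← Matrix.mulVec_transpose, this, dotProduct_comm]

theorem quad_add_right (hM : M.IsHermitian) (v : Fin d → ℝ) :
    quad M (u + v) = quad M u + 2 * (u ⬝ᵥ M *ᵥ v) + quad M v := by
  simp only [quad, Matrix.mulVec_add, dotProduct_add, add_dotProduct]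
  rw [dotProduct_mulVec_comm M v hM u]; ring

theorem quad_sub_right (hM : M.IsHermitian) (v : Fin d → ℝ) :
    quad M (u - v) = quad M u - 2 * (u ⬝ᵥ M *ᵥ v) + quad M v := by
  simp only [quad, Matrix.mulVec_sub, dotProduct_sub, sub_dotProduct]
  rw [dotProduct_mulVec_comm M v hM u]; ring

end Quad

/-! ### Spectral decomposition and square roots. -/

/-- The spectral decomposition with the eigenvalues in nonincreasing order. -/
theorem exists_orthogonal_diagonal_sortedEig {d : ℕ} {M : Matrix (Fin d) (Fin d) ℝ}
    (hM : M.IsHermitian) :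
    ∃ V ∈ Matrix.orthogonalGroup (Fin d) ℝ, M = V * Matrix.diagonal (sortedEig hM) * Vᵀ := by
  -- `eigenvalues` is `eigenvalues₀` reindexed along an arbitrary equivalence; permuting the
  -- eigenvector columns by `π` undoes this.
  let π : Fin d ≃ Fin d := (finCongr (Fintype.card_fin d).symm).trans
    (Fintype.equivOfCardEq (Fintype.card_fin _))
  have hπ : sortedEig hM = hM.eigenvalues ∘ π := by
    ext i
    simp [sortedEig, Matrix.IsHermitian.eigenvalues, π]
  let U : Matrix (Fin d) (Fin d) ℝ := hM.eigenvectorUnitary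
  have hU : U * Uᵀ = 1 := (Matrix.mem_orthogonalGroup_iff (Fin d) ℝ).mp hM.eigenvectorUnitary.2
  have hUM : M = U * Matrix.diagonal hM.eigenvalues * Uᵀ := by
    have := hM.spectral_theorem
    rw [Unitary.conjStarAlgAut_apply] at this
    exact this
  refine ⟨U.submatrix id π, ?_, ?_⟩
  · rw [Matrix.mem_orthogonalGroup_iff]
    change U.submatrix id π * (U.submatrix id π)ᵀ = 1
    rw [Matrix.transpose_submatrix, Matrix.submatrix_mul_equiv, hU]
    simp
  · rw [hπ, ← Matrix.submatrix_diagonal_equiv, Matrix.submatrix_mul_equiv,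
      Matrix.transpose_submatrix, Matrix.submatrix_mul_equiv, ← hUM]
    simp

theorem quad_eq_sum_of_eq {d : ℕ} {M V : Matrix (Fin d) (Fin d) ℝ} {l : Fin d → ℝ}
    (h : M = V * Matrix.diagonal l * Vᵀ) (u : Fin d → ℝ) :
    quad M u = ∑ i, l i * (Vᵀ *ᵥ u) i ^ 2 := by
  rw [h, quad_mul_mul_transpose]
  simp only [quad, Matrix.mulVec_diagonal, dotProduct]
  exact Finset.sum_congr rfl fun i _ => by ring

/-- The `i`-th column of `V` is an eigenvector. -/
theorem quad_mulVec_single {d : ℕ} {M V : Matrix (Fin d) (Fin d) ℝ} {l : Fin d → ℝ}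
    (hV : V ∈ Matrix.orthogonalGroup (Fin d) ℝ) (h : M = V * Matrix.diagonal l * Vᵀ) (i : Fin d) :
    quad M (V *ᵥ Pi.single i 1) = l i ∧ (V *ᵥ Pi.single i 1) ⬝ᵥ (V *ᵥ Pi.single i 1) = 1 := by
  have hV' : Vᵀ * V = 1 := (Matrix.mem_orthogonalGroup_iff' (Fin d) ℝ).mp hV
  constructor
  · rw [quad_eq_sum_of_eq h, Matrix.mulVec_mulVec, hV', Matrix.one_mulVec]
    simp [Pi.single_apply]
  · rw [← quad_transpose_mul_self, hV', quad_one]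
    simp

theorem one_le_sortedEig {d : ℕ} {M : Matrix (Fin d) (Fin d) ℝ} (hM : M.IsHermitian)
    (h : ∀ u, u ⬝ᵥ u ≤ quad M u) (i : Fin d) : 1 ≤ sortedEig hM i := by
  obtain ⟨V, hV, hVM⟩ := exists_orthogonal_diagonal_sortedEig hM
  obtain ⟨h1, h2⟩ := quad_mulVec_single hV hVM i
  exact (h2.symm.le.trans (h _)).trans h1.le

/-- A symmetric matrix `M ⪰ I` is `Rᵀ R` with `R` invertible. -/
theorem exists_transpose_mul_self_eq {d : ℕ} {M : Matrix (Fin d) (Fin d) ℝ} (hM : M.IsHermitian)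
    (h : ∀ u, u ⬝ᵥ u ≤ quad M u) :
    ∃ R R' : Matrix (Fin d) (Fin d) ℝ, M = Rᵀ * R ∧ R * R' = 1 ∧ R' * R = 1 := by
  obtain ⟨V, hV, hVM⟩ := exists_orthogonal_diagonal_sortedEig hM
  have hV' : Vᵀ * V = 1 := (Matrix.mem_orthogonalGroup_iff' (Fin d) ℝ).mp hV
  have h1 := one_le_sortedEig hM h
  have key : (Matrix.diagonal (fun i => √(sortedEig hM i)) * Vᵀ) *
      (V * Matrix.diagonal (fun i => (√(sortedEig hM i))⁻¹)) = 1 := by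
    rw [Matrix.mul_assoc, ← Matrix.mul_assoc Vᵀ, hV', Matrix.one_mul, Matrix.diagonal_mul_diagonal,
      ← Matrix.diagonal_one]
    congr 1
    ext i
    exact mul_inv_cancel₀ (Real.sqrt_pos.mpr (by linarith [h1 i])).ne'
  refine ⟨_, _, hVM.trans ?_, key, mul_eq_one_comm.mp key⟩
  rw [Matrix.transpose_mul, Matrix.transpose_transpose, Matrix.diagonal_transpose,
    Matrix.mul_assoc V, Matrix.mul_assoc V, ← Matrix.mul_assoc (Matrix.diagonal _)
    (Matrix.diagonal _), Matrix.diagonal_mul_diagonal]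
  congr 3
  ext i
  exact (Real.mul_self_sqrt (by linarith [h1 i])).symm

/-! ### Nets adapted to a quadratic form. -/

/-- The unit ball of a finite-dimensional space has a `1/2`-net with at most `5 ^ dim` elements. -/
theorem exists_half_net (E : Type*) [NormedAddCommGroup E] [NormedSpace ℝ E]
    [FiniteDimensional ℝ E] :
    ∃ N : Finset E, N.card ≤ 5 ^ Module.finrank ℝ E ∧ (∀ p ∈ N, ‖p‖ ≤ 1) ∧
      ∀ u : E, ‖u‖ ≤ 1 → ∃ p ∈ N, ‖u - p‖ ≤ 1 / 2 := by
  classical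
  -- A separated set of maximal cardinality is a net. After doubling, the set is `1`-separated in
  -- the ball of radius `2`, so the packing bound `5 ^ dim` applies.
  let good (N : Finset E) : Prop :=
    (∀ p ∈ N, ‖p‖ ≤ 1) ∧ ∀ p ∈ N, ∀ q ∈ N, p ≠ q → 1 / 2 ≤ ‖p - q‖
  have hcard : ∀ N : Finset E, good N → N.card ≤ 5 ^ Module.finrank ℝ E := by
    intro N hN
    have hinj : Function.Injective (fun p : E => (2 : ℝ) • p) := smul_right_injective E two_ne_zero
    rw [← Finset.card_image_of_injective N hinj]
    apply Besicovitch.card_le_of_separated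
    · simp only [Finset.mem_image, forall_exists_index, and_imp, forall_apply_eq_imp_iff₂]
      intro p hp
      rw [norm_smul]
      have := hN.1 p hp
      norm_num
      linarith
    · simp only [Finset.mem_image, forall_exists_index, and_imp, forall_apply_eq_imp_iff₂]
      intro p hp q hq hpq
      rw [← smul_sub, norm_smul]
      have := hN.2 p hp q hq (fun h => hpq (by rw [h]))
      norm_num
      linarith
  let s : Set ℕ := {k | ∃ N : Finset E, good N ∧ N.card = k}
  have hs : s.Nonempty := ⟨0, ∅, by simp [good], by simp⟩
  have hb : BddAbove s := ⟨5 ^ Module.finrank ℝ E, by rintro _ ⟨N, hN, rfl⟩; exact hcard N hN⟩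
  obtain ⟨N, hN, hNs⟩ := Nat.sSup_mem hs hb
  refine ⟨N, hcard N hN, hN.1, fun u hu => ?_⟩
  by_contra! hcon
  have hu' : u ∉ N := fun h => absurd (hcon u h) (by simp)
  have hgood : good (insert u N) := by
    refine ⟨by simpa [hu] using hN.1, ?_⟩
    intro p hp q hq hpq
    rcases Finset.mem_insert.mp hp with hp | hp <;> rcases Finset.mem_insert.mp hq with hq | hq
    · exact absurd (hp.trans hq.symm) hpq
    · rw [hp]; exact (hcon q hq).le
    · rw [hq, norm_sub_rev]; exact (hcon p hp).le
    · exact hN.2 p hp q hq hpq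
  have := le_csSup hb ⟨_, hgood, rfl⟩
  rw [Finset.card_insert_of_notMem hu'] at this
  omega

theorem dotProduct_self_eq_norm_sq {d : ℕ} (u : Fin d → ℝ) :
    u ⬝ᵥ u = ‖WithLp.toLp 2 u‖ ^ 2 := by
  rw [EuclideanSpace.norm_sq_eq]
  simp [dotProduct, sq]

/-- `N` is a net of the unit ball of the norm `u ↦ √(uᵀ M u)` that controls linear functionals. -/
def IsFormNet {d : ℕ} (M : Matrix (Fin d) (Fin d) ℝ) (N : Finset (Fin d → ℝ)) : Prop :=
  (∀ p ∈ N, quad M p ≤ 1) ∧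
    ∀ (a : Fin d → ℝ) (κ : ℝ), (∀ p ∈ N, a ⬝ᵥ p ≤ κ) → ∀ u, a ⬝ᵥ u ≤ 2 * κ * √(quad M u)

theorem exists_isFormNet {d : ℕ} {M : Matrix (Fin d) (Fin d) ℝ} (hM : M.IsHermitian)
    (h : ∀ u, u ⬝ᵥ u ≤ quad M u) :
    ∃ N : Finset (Fin d → ℝ), N.card ≤ 5 ^ d ∧ IsFormNet M N := by
  classical
  -- With `M = Rᵀ R`, the map `R` is an isometry from the `M`-norm to the Euclidean norm, so the
  -- Euclidean net is pulled back along `R`.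
  obtain ⟨R, R', hR, hRR', hR'R⟩ := exists_transpose_mul_self_eq hM h
  obtain ⟨N, hcard, hN1, hN2⟩ := exists_half_net (EuclideanSpace ℝ (Fin d))
  have hq : ∀ u, quad M u = ‖WithLp.toLp 2 (R *ᵥ u)‖ ^ 2 := fun u => by
    rw [hR, quad_transpose_mul_self, dotProduct_self_eq_norm_sq]
  refine ⟨N.image fun w => R' *ᵥ w.ofLp, ?_, ?_, ?_⟩
  · exact Finset.card_image_le.trans (by simpa using hcard)
  · simp only [Finset.mem_image, forall_exists_index, and_imp, forall_apply_eq_imp_iff₂]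
    intro w hw
    rw [hq, Matrix.mulVec_mulVec, hRR', Matrix.one_mulVec]
    have := hN1 w hw
    exact pow_le_one₀ (norm_nonneg _) this
  · intro a κ ha u
    let b : EuclideanSpace ℝ (Fin d) := WithLp.toLp 2 (R'ᵀ *ᵥ a)
    have hab : ∀ v, a ⬝ᵥ R' *ᵥ v = inner ℝ b (WithLp.toLp 2 v) := fun v => by
      rw [Matrix.dotProduct_mulVec, ← Matrix.mulVec_transpose]
      simp [b, PiLp.inner_apply, dotProduct, mul_comm]
    -- A net point within `1/2` of the direction of `b` loses at most half of `‖b‖`; this is the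
    -- factor `2`.
    have hb : ‖b‖ ≤ 2 * κ := by
      obtain ⟨w, hw, hbw⟩ := hN2 (‖b‖⁻¹ • b) (by
        rw [norm_smul, norm_inv, norm_norm]; exact inv_mul_le_one)
      have h1 : inner ℝ b w ≤ κ := by
        have := ha _ (Finset.mem_image_of_mem _ hw)
        rwa [hab] at this
      have h2 : inner ℝ b (‖b‖⁻¹ • b - w) ≤ ‖b‖ * (1 / 2) :=
        (real_inner_le_norm _ _).trans (by gcongr)
      have h3 : inner ℝ b (‖b‖⁻¹ • b) = ‖b‖ := by
        rw [inner_smul_right, real_inner_self_eq_norm_sq]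
        by_cases hb0 : ‖b‖ = 0
        · simp [hb0]
        · field_simp
      rw [inner_sub_right, h3] at h2
      linarith
    have hu : a ⬝ᵥ u = inner ℝ b (WithLp.toLp 2 (R *ᵥ u)) := by
      rw [← hab, Matrix.mulVec_mulVec, hR'R, Matrix.one_mulVec]
    rw [hu, hq, Real.sqrt_sq (norm_nonneg _)]
    exact (real_inner_le_norm _ _).trans (by gcongr)

/-- The net property is applied in each argument in turn, and each application costs a factor `2`.
-/
theorem IsFormNet.bilin_le {d : ℕ} {M₁ M₂ : Matrix (Fin d) (Fin d) ℝ} {N₁ N₂ : Finset (Fin d → ℝ)}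
    (h₁ : IsFormNet M₁ N₁) (h₂ : IsFormNet M₂ N₂) (B : Matrix (Fin d) (Fin d) ℝ) (κ : ℝ)
    (h : ∀ p ∈ N₁, ∀ q ∈ N₂, p ⬝ᵥ B *ᵥ q ≤ κ) (u v : Fin d → ℝ) :
    u ⬝ᵥ B *ᵥ v ≤ 4 * κ * √(quad M₁ u) * √(quad M₂ v) := by
  rw [dotProduct_comm]
  have := h₁.2 (B *ᵥ v) (2 * κ * √(quad M₂ v)) (fun p hp => ?_) u
  · linarith
  · rw [dotProduct_comm, Matrix.dotProduct_mulVec]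
    exact h₂.2 _ κ (fun q hq => by rw [← Matrix.dotProduct_mulVec]; exact h p hp q hq) v

/-! ### Gramians and the Lyapunov equation. -/

section Gramian

open Filter Topology

variable {d : ℕ} {A : Matrix (Fin d) (Fin d) ℝ}

/-- The entries of the powers of a stable matrix decay geometrically. -/
theorem IsSchurStable.exists_entry_le (hA : IsSchurStable A) :
    ∃ q : ℝ, 0 ≤ q ∧ q < 1 ∧ ∀ᶠ k : ℕ in atTop, ∀ i j, |(A ^ k) i j| ≤ q ^ k := by
  let _ : NormedRing (Matrix (Fin d) (Fin d) ℂ) := Matrix.linftyOpNormedRing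
  let _ : NormedAlgebra ℂ (Matrix (Fin d) (Fin d) ℂ) := Matrix.linftyOpNormedAlgebra
  let Ac : Matrix (Fin d) (Fin d) ℂ := A.map (algebraMap ℝ ℂ)
  have hlim := spectrum.pow_nnnorm_pow_one_div_tendsto_nhds_spectralRadius Ac
  obtain ⟨q, hq, hq1⟩ := ENNReal.lt_iff_exists_nnreal_btwn.mp hA
  refine ⟨q, q.2, by exact_mod_cast hq1, ?_⟩
  filter_upwards [hlim.eventually_lt_const hq, eventually_gt_atTop 0] with k hk hk0 i j
  have hk1 : (‖Ac ^ k‖₊ : ℝ≥0∞) ≤ q ^ k := by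
    have hk' : (0 : ℝ) < k := by exact_mod_cast hk0
    rw [one_div, ENNReal.rpow_inv_lt_iff hk'] at hk
    exact_mod_cast hk.le
  have hk2 : ‖Ac ^ k‖ ≤ (q : ℝ) ^ k := by
    have : ‖Ac ^ k‖₊ ≤ q ^ k := by exact_mod_cast hk1
    exact_mod_cast this
  have hAk : (Ac ^ k) i j = (((A ^ k) i j : ℝ) : ℂ) := by
    have : Ac ^ k = (A ^ k).map (algebraMap ℝ ℂ) := (map_pow (algebraMap ℝ ℂ).mapMatrix A k).symm
    rw [this]; rfl
  refine le_trans ?_ hk2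
  rw [← Real.norm_eq_abs, ← Complex.norm_real, ← hAk, Matrix.linfty_opNorm_def]
  have h1 : ‖(Ac ^ k) i j‖₊ ≤ ∑ j, ‖(Ac ^ k) i j‖₊ :=
    Finset.single_le_sum (f := fun j => ‖(Ac ^ k) i j‖₊) (fun _ _ => zero_le) (Finset.mem_univ j)
  have h2 : ∑ j, ‖(Ac ^ k) i j‖₊ ≤ Finset.univ.sup fun i => ∑ j, ‖(Ac ^ k) i j‖₊ :=
    Finset.le_sup (f := fun i => ∑ j, ‖(Ac ^ k) i j‖₊) (Finset.mem_univ i)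
  exact_mod_cast h1.trans h2

theorem IsSchurStable.tendsto_pow (hA : IsSchurStable A) :
    Tendsto (fun k : ℕ => A ^ k) atTop (𝓝 0) := by
  obtain ⟨q, hq0, hq1, hq⟩ := hA.exists_entry_le
  refine tendsto_pi_nhds.mpr fun i => tendsto_pi_nhds.mpr fun j => ?_
  apply squeeze_zero_norm' _ (tendsto_pow_atTop_nhds_zero_of_lt_one hq0 hq1)
  filter_upwards [hq] with k hk using hk i j

/-- The Gramian `∑_{k ≥ 0} A^k S (A^k)ᵀ` for noise with covariance `S`. -/
noncomputable def gramian (A S : Matrix (Fin d) (Fin d) ℝ) : Matrix (Fin d) (Fin d) ℝ :=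
  ∑' k : ℕ, A ^ k * S * (A ^ k)ᵀ

theorem gramian_one (A : Matrix (Fin d) (Fin d) ℝ) : gramian A 1 = gramianInf A := by
  simp [gramian, gramianInf]

theorem IsSchurStable.summable_gramian (hA : IsSchurStable A) (S : Matrix (Fin d) (Fin d) ℝ) :
    Summable fun k : ℕ => A ^ k * S * (A ^ k)ᵀ := by
  obtain ⟨q, hq0, hq1, hq⟩ := hA.exists_entry_le
  refine Pi.summable.mpr fun i => Pi.summable.mpr fun j => ?_
  simp only [Matrix.mul_apply, Matrix.transpose_apply, Finset.sum_mul]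
  refine summable_sum fun b _ => summable_sum fun a _ => ?_
  refine Summable.of_norm_bounded_eventually_nat
    ((summable_geometric_of_lt_one hq0 hq1).mul_right |S a b|) ?_
  filter_upwards [hq] with k hk
  rw [Real.norm_eq_abs, abs_mul, abs_mul]
  have h1 := hk i a
  have h2 : |(A ^ k) j b| ≤ 1 := (hk j b).trans (pow_le_one₀ hq0 hq1.le)
  calc |(A ^ k) i a| * |S a b| * |(A ^ k) j b| ≤ q ^ k * |S a b| * 1 := by gcongr
    _ = _ := mul_one _

theorem gramian_isHermitian (A : Matrix (Fin d) (Fin d) ℝ) {S : Matrix (Fin d) (Fin d) ℝ}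
    (hS : S.IsHermitian) : (gramian A S).IsHermitian := by
  have hS' : Sᵀ = S := by simpa using hS.eq
  unfold Matrix.IsHermitian gramian
  rw [Matrix.conjTranspose_eq_transpose_of_trivial, Matrix.transpose_tsum]
  simp [Matrix.transpose_mul, hS', Matrix.mul_assoc]

/-- The discrete Lyapunov equation. -/
theorem IsSchurStable.gramian_eq (hA : IsSchurStable A) (S : Matrix (Fin d) (Fin d) ℝ) :
    gramian A S = A * gramian A S * Aᵀ + S := by
  have hs := hA.summable_gramian S
  have h1 : gramian A S = S + ∑' k : ℕ, A ^ (k + 1) * S * (A ^ (k + 1))ᵀ := by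
    rw [gramian, hs.tsum_eq_zero_add]; simp
  rw [h1, add_comm]
  congr 1
  rw [add_comm, ← h1, gramian, ← hs.tsum_mul_left, ← (hs.mul_left A).tsum_mul_right]
  refine tsum_congr fun k => ?_
  rw [pow_succ' A k, Matrix.transpose_mul]
  simp only [Matrix.mul_assoc]

theorem continuous_quad (u : Fin d → ℝ) : Continuous fun M : Matrix (Fin d) (Fin d) ℝ => quad M u := by
  unfold quad Matrix.mulVec dotProduct
  fun_prop

/-- A matrix `D` with `D ⪰ A D Aᵀ` is positive semidefinite if `A` is stable. -/
theorem IsSchurStable.quad_nonneg (hA : IsSchurStable A) {D : Matrix (Fin d) (Fin d) ℝ}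
    (hD : ∀ u, quad (A * D * Aᵀ) u ≤ quad D u) (u : Fin d → ℝ) : 0 ≤ quad D u := by
  -- Conjugating the hypothesis by powers of `A` makes `A^k D (A^k)ᵀ` decrease from `D`, and
  -- stability sends it to `0`.
  have hk : ∀ k : ℕ, quad (A ^ k * D * (A ^ k)ᵀ) u ≤ quad D u := by
    intro k
    induction k generalizing u with
    | zero => simp
    | succ k ih =>
      refine le_trans ?_ (ih u)
      rw [quad_mul_mul_transpose _ D, pow_succ, Matrix.transpose_mul, ← Matrix.mulVec_mulVec,
        quad_mul_mul_transpose (A ^ k), ← quad_mul_mul_transpose A]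
      exact hD _
  have hlim : Tendsto (fun k : ℕ => quad (A ^ k * D * (A ^ k)ᵀ) u) atTop (𝓝 0) := by
    have h0 : quad ((0 : Matrix (Fin d) (Fin d) ℝ) * D * 0ᵀ) u = 0 := by simp [quad]
    rw [← h0]
    refine ((continuous_quad u).tendsto _).comp ?_
    have hc : Continuous fun B : Matrix (Fin d) (Fin d) ℝ => B * D * Bᵀ := by fun_prop
    exact (hc.tendsto 0).comp hA.tendsto_pow
  exact le_of_tendsto hlim (Eventually.of_forall hk)

/-- By the Lyapunov equations, the difference `D` of the Gramians satisfies `D - A D Aᵀ = T - S ⪰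
0`, so stability gives `D ⪰ 0`. -/
theorem IsSchurStable.gramian_mono (hA : IsSchurStable A) {S T : Matrix (Fin d) (Fin d) ℝ}
    (h : ∀ u, quad S u ≤ quad T u) (u : Fin d → ℝ) : quad (gramian A S) u ≤ quad (gramian A T) u := by
  have := hA.quad_nonneg (D := gramian A T - gramian A S) (fun u => ?_) u
  · rw [quad_sub] at this; linarith
  · rw [Matrix.mul_sub, Matrix.sub_mul, quad_sub, quad_sub]
    have h1 := congrArg (quad · u) (hA.gramian_eq S)
    have h2 := congrArg (quad · u) (hA.gramian_eq T)
    simp only [quad_add] at h1 h2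
    linarith [h u]

theorem gramian_smul (A S : Matrix (Fin d) (Fin d) ℝ) (c : ℝ) :
    gramian A (c • S) = c • gramian A S := by
  simp only [gramian, Matrix.mul_smul, Matrix.smul_mul, tsum_const_smul'']

/-- The Lyapunov equation splits the Gramian into two positive semidefinite summands; each is
dominated by the total. -/
theorem IsSchurStable.quad_le_quad_gramian (hA : IsSchurStable A) {S : Matrix (Fin d) (Fin d) ℝ}
    (hS : ∀ u, 0 ≤ quad S u) (u : Fin d → ℝ) :
    quad (A * gramian A S * Aᵀ) u ≤ quad (gramian A S) u ∧ quad S u ≤ quad (gramian A S) u := by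
  have h0 : ∀ u, 0 ≤ quad (gramian A S) u := fun u =>
    hA.quad_nonneg (fun u => by
      have h1 := congrArg (quad · u) (hA.gramian_eq S)
      simp only [quad_add] at h1
      linarith [hS u]) u
  have h1 := congrArg (quad · u) (hA.gramian_eq S)
  simp only [quad_add] at h1
  have h2 := h0 (Aᵀ *ᵥ u)
  rw [← quad_mul_mul_transpose] at h2
  exact ⟨by linarith [hS u], by linarith⟩

end Gramian

/-! ### The spectral norm and the smallest eigenvalue -/

theorem quad_le_opNorm {d : ℕ} (M : Matrix (Fin d) (Fin d) ℝ) (u : Fin d → ℝ) :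
    quad M u ≤ opNorm M * (u ⬝ᵥ u) := by
  let _ : NormedAddCommGroup (Matrix (Fin d) (Fin d) ℝ) := Matrix.instL2OpNormedAddCommGroup
  have h := Matrix.l2_opNorm_mulVec M (WithLp.toLp 2 u)
  have h1 : quad M u = inner ℝ (WithLp.toLp 2 u) (WithLp.toLp 2 (M *ᵥ u)) := by
    simp [quad, PiLp.inner_apply, dotProduct, mul_comm]
  rw [h1, dotProduct_self_eq_norm_sq]
  refine (real_inner_le_norm _ _).trans ?_
  have h2 : ‖WithLp.toLp 2 (M *ᵥ u)‖ ≤ opNorm M * ‖WithLp.toLp 2 u‖ := h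
  nlinarith [norm_nonneg (WithLp.toLp 2 u)]

/-- For `Γ ⪰ I` this gives `‖Γ‖ ≥ 1` and `‖Γ‖³ / λ_min ≥ ‖Γ‖`, the form in which the burn-in
condition is used. -/
theorem minEig_bounds {d : ℕ} (hd : 0 < d) {M : Matrix (Fin d) (Fin d) ℝ} (hM : M.IsHermitian)
    (h : ∀ u, u ⬝ᵥ u ≤ quad M u) : 1 ≤ minEig hM ∧ minEig hM ≤ opNorm M := by
  have : Nonempty (Fin d) := ⟨⟨0, hd⟩⟩
  have h1 := one_le_sortedEig hM h
  refine ⟨le_ciInf h1, ?_⟩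
  have h2 : minEig hM ≤ sortedEig hM ⟨0, hd⟩ := ciInf_le ⟨1, by rintro _ ⟨i, rfl⟩; exact h1 i⟩ _
  obtain ⟨V, hV, hVM⟩ := exists_orthogonal_diagonal_sortedEig hM
  obtain ⟨h3, h4⟩ := quad_mulVec_single hV hVM ⟨0, hd⟩
  have h5 := quad_le_opNorm M (V *ᵥ Pi.single ⟨0, hd⟩ 1)
  rw [h3, h4, mul_one] at h5
  exact h2.trans h5

/-! ### The Frobenius norm -/

theorem frobNorm_nonneg {m n : ℕ} (M : Matrix (Fin m) (Fin n) ℝ) : 0 ≤ frobNorm M :=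
  letI := Matrix.frobeniusNormedAddCommGroup (m := Fin m) (n := Fin n) (α := ℝ)
  norm_nonneg M

theorem frobNorm_sq {m n : ℕ} (M : Matrix (Fin m) (Fin n) ℝ) :
    frobNorm M ^ 2 = (Mᵀ * M).trace := by
  have h : frobNorm M = (∑ i, ∑ j, ‖M i j‖ ^ (2 : ℝ)) ^ (1 / 2 : ℝ) := Matrix.frobenius_norm_def M
  rw [h, ← Real.sqrt_eq_rpow, Real.sq_sqrt (by positivity), Finset.sum_comm]
  simp [Matrix.trace, Matrix.mul_apply, sq]

theorem frobNorm_sq_eq_sum {m n : ℕ} (M : Matrix (Fin m) (Fin n) ℝ) :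
    frobNorm M ^ 2 = ∑ i, ∑ j, M i j ^ 2 := by
  rw [frobNorm_sq, Finset.sum_comm]
  simp [Matrix.trace, Matrix.mul_apply, sq]

theorem frobNorm_sub_sq {m n : ℕ} (M N : Matrix (Fin m) (Fin n) ℝ) :
    frobNorm (M - N) ^ 2 = frobNorm M ^ 2 - 2 * (Mᵀ * N).trace + frobNorm N ^ 2 := by
  have h : (Nᵀ * M).trace = (Mᵀ * N).trace := by
    rw [← Matrix.trace_transpose, Matrix.transpose_mul, Matrix.transpose_transpose]
  simp only [frobNorm_sq, Matrix.transpose_sub, Matrix.sub_mul, Matrix.mul_sub, Matrix.trace_sub, h]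
  ring

theorem frobNorm_orthogonal_mul_sq {d n : ℕ} {U : Matrix (Fin d) (Fin d) ℝ} (hU : Uᵀ * U = 1)
    (M : Matrix (Fin d) (Fin n) ℝ) : frobNorm (U * M) ^ 2 = frobNorm M ^ 2 := by
  rw [frobNorm_sq, frobNorm_sq, Matrix.transpose_mul, Matrix.mul_assoc, ← Matrix.mul_assoc Uᵀ, hU,
    Matrix.one_mul]

theorem frobNorm_mul_orthogonal_sq {d n : ℕ} {V : Matrix (Fin d) (Fin d) ℝ} (hV : V * Vᵀ = 1)
    (M : Matrix (Fin n) (Fin d) ℝ) : frobNorm (M * V) ^ 2 = frobNorm M ^ 2 := by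
  rw [frobNorm_sq, frobNorm_sq, Matrix.transpose_mul, Matrix.mul_assoc, Matrix.trace_mul_comm,
    ← Matrix.mul_assoc, Matrix.mul_assoc, hV, Matrix.mul_one]

theorem frobNorm_diagonal_sq {d : ℕ} (s : Fin d → ℝ) :
    frobNorm (Matrix.diagonal s) ^ 2 = ∑ i, s i ^ 2 := by
  rw [frobNorm_sq]
  simp [Matrix.diagonal_transpose, Matrix.diagonal_mul_diagonal, Matrix.trace, sq]

/-! ### Weighted sums -/

/-- After subtracting the threshold `t`, a term `(a i - t) * w i` is largest for full weight on `T`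
and zero weight off `T`. The multiple of `t` accounts for the difference between the total weight
and the size of `T`. -/
theorem sum_mul_weight_le {ι : Type*} [Fintype ι] (a w : ι → ℝ) (T : Finset ι) (t : ℝ)
    (h0 : ∀ i, 0 ≤ w i) (h1 : ∀ i, w i ≤ 1) (hT : ∀ i ∈ T, t ≤ a i) (hT' : ∀ i ∉ T, a i ≤ t) :
    ∑ i, a i * w i ≤ ∑ i ∈ T, a i + (∑ i, w i - T.card) * t := by
  classical
  have h : ∑ i, (a i - t) * w i ≤ ∑ i, if i ∈ T then a i - t else 0 := by
    refine Finset.sum_le_sum fun i _ => ?_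
    split_ifs with hi
    · nlinarith [hT i hi, h1 i]
    · nlinarith [hT' i hi, h0 i]
  rw [Finset.sum_ite_mem, Finset.univ_inter, Finset.sum_sub_distrib, Finset.sum_const,
    nsmul_eq_mul] at h
  simp only [sub_mul, Finset.sum_sub_distrib, ← Finset.mul_sum] at h
  linarith

theorem card_filter_fin_lt {d r : ℕ} (hr : r ≤ d) :
    (Finset.univ.filter fun i : Fin d => (i : ℕ) < r).card = r := by
  rw [Fin.card_filter_val_lt, min_eq_right hr]

theorem card_filter_fin_ge {d r : ℕ} (hr : r ≤ d) :
    (Finset.univ.filter fun i : Fin d => d - r ≤ (i : ℕ)).card = r := by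
  have h1 := card_filter_fin_lt (Nat.sub_le d r)
  have h2 := Finset.card_filter_add_card_filter_not (s := (Finset.univ : Finset (Fin d)))
    (fun i : Fin d => (i : ℕ) < d - r)
  simp only [not_lt, Finset.card_univ, Fintype.card_fin] at h2
  omega

/-- Weights `w ∈ [0, 1]` of total mass at most `r` do not beat the `r` largest terms. -/
theorem sum_mul_weight_le_of_antitone {d r : ℕ} (h1r : 1 ≤ r) (hr : r ≤ d) {a w : Fin d → ℝ}
    (ha : Antitone a) (ha0 : ∀ i, 0 ≤ a i) (h0 : ∀ i, 0 ≤ w i) (h1 : ∀ i, w i ≤ 1)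
    (hw : ∑ i, w i ≤ r) :
    ∑ i, a i * w i ≤ ∑ i : Fin d with i.val < r, a i := by
  have h := sum_mul_weight_le a w (Finset.univ.filter fun i : Fin d => (i : ℕ) < r)
    (a ⟨r - 1, by omega⟩) h0 h1
    (fun i hi => ha (by simp at hi; rw [Fin.le_def]; simp; omega))
    (fun i hi => ha (by simp at hi; rw [Fin.le_def]; simp; omega))
  rw [card_filter_fin_lt hr] at h
  nlinarith [ha0 ⟨r - 1, by omega⟩]

/-- Weights `w ∈ [0, 1]` of total mass at most `2 r` do not beat twice the `r` largest terms. -/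
theorem sum_mul_weight_le_of_monotone {d r : ℕ} (h1r : 1 ≤ r) (hr : r ≤ d) {a w : Fin d → ℝ}
    (ha : Monotone a) (ha0 : ∀ i, 0 ≤ a i) (h0 : ∀ i, 0 ≤ w i) (h1 : ∀ i, w i ≤ 1)
    (hw : ∑ i, w i ≤ 2 * r) :
    ∑ i, a i * w i ≤ 2 * ∑ i : Fin d with d - r ≤ i.val, a i := by
  have hT : ∀ i ∈ Finset.univ.filter (fun i : Fin d => d - r ≤ (i : ℕ)),
      a ⟨d - r, by omega⟩ ≤ a i :=
    fun i hi => ha (by simp at hi; rw [Fin.le_def]; simp; omega)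
  have h := sum_mul_weight_le a w (Finset.univ.filter fun i : Fin d => d - r ≤ (i : ℕ))
    (a ⟨d - r, by omega⟩) h0 h1 hT
    (fun i hi => ha (by simp at hi; rw [Fin.le_def]; simp; omega))
  -- The excess mass over `r` is at most `r` and is charged at the threshold, which costs at most
  -- one further copy of the sum of the `r` largest terms. The case `2 r > d` needs no separate
  -- treatment.
  have h2 := Finset.card_nsmul_le_sum _ a _ hT
  rw [card_filter_fin_ge hr] at h h2
  rw [nsmul_eq_mul] at h2
  nlinarith [ha0 ⟨d - r, by omega⟩]

/-- The squared lengths of the projections of the standard basis to the first `m` columns of an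
orthogonal matrix. -/
theorem orthogonal_weights {d : ℕ} {Q : Matrix (Fin d) (Fin d) ℝ} (hQ : Q * Qᵀ = 1)
    (m : ℕ) :
    (∀ k, 0 ≤ ∑ i : Fin d with i.val < m, Q k i ^ 2) ∧ (∀ k, ∑ i : Fin d with i.val < m, Q k i ^ 2 ≤ 1) ∧
      ∑ k, ∑ i : Fin d with i.val < m, Q k i ^ 2 ≤ m := by
  have hQ' : Qᵀ * Q = 1 := mul_eq_one_comm.mp hQ
  refine ⟨fun k => by positivity, fun k => ?_, ?_⟩
  · have h := congrFun (congrFun hQ k) k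
    simp only [Matrix.mul_apply, Matrix.transpose_apply, Matrix.one_apply_eq] at h
    rw [← h]
    simp only [← sq]
    exact Finset.sum_le_sum_of_subset_of_nonneg (Finset.filter_subset _ _)
      fun _ _ _ => sq_nonneg _
  · rw [Finset.sum_comm]
    have h : ∀ i, ∑ k, Q k i ^ 2 = 1 := fun i => by
      have h := congrFun (congrFun hQ' i) i
      simp only [Matrix.mul_apply, Matrix.transpose_apply, Matrix.one_apply_eq] at h
      simpa only [← sq] using h
    simp only [h, Finset.sum_const, nsmul_eq_mul, mul_one]
    rw [Fin.card_filter_val_lt]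
    exact_mod_cast min_le_right _ _

/-! ### Singular value decompositions and truncation -/

theorem rank_orthogonal_mul_mul {d : ℕ} {U V : Matrix (Fin d) (Fin d) ℝ} (hU : U * Uᵀ = 1)
    (hV : V * Vᵀ = 1) (M : Matrix (Fin d) (Fin d) ℝ) : (U * M * Vᵀ).rank = M.rank := by
  rw [Matrix.rank_mul_eq_left_of_isUnit_det, Matrix.rank_mul_eq_right_of_isUnit_det]
  · exact (Matrix.isUnit_iff_isUnit_det _).mp (IsUnit.of_mul_eq_one _ hU)
  · exact (Matrix.isUnit_iff_isUnit_det _).mp (IsUnit.of_mul_eq_one _ (mul_eq_one_comm.mp hV))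

theorem rank_sub_le {d : ℕ} (A B : Matrix (Fin d) (Fin d) ℝ) :
    (A - B).rank ≤ A.rank + B.rank := by
  refine le_trans (Submodule.finrank_mono ?_) (Submodule.finrank_add_le_finrank_add_finrank
    (LinearMap.range A.mulVecLin) (LinearMap.range B.mulVecLin))
  rintro _ ⟨v, rfl⟩
  rw [Matrix.mulVecLin_apply, Matrix.sub_mulVec]
  exact Submodule.sub_mem _ (Submodule.mem_sup_left ⟨v, rfl⟩) (Submodule.mem_sup_right ⟨v, rfl⟩)

/-- Sorted nonnegative singular values are nonzero exactly on an initial segment, whose length is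
the rank. -/
theorem exists_svd {d : ℕ} (M : Matrix (Fin d) (Fin d) ℝ) :
    ∃ U V : Matrix (Fin d) (Fin d) ℝ, U * Uᵀ = 1 ∧ V * Vᵀ = 1 ∧ ∃ s : Fin d → ℝ,
      (∀ i : Fin d, M.rank ≤ i → s i = 0) ∧ M = U * Matrix.diagonal s * Vᵀ := by
  -- The truncation level `0` is immaterial: only the decomposition is kept.
  obtain ⟨_, U, hU, V, hV, s, hs, hs0, hM, _⟩ := exists_isTruncatedSVD 0 M
  have hU' : U * Uᵀ = 1 := (Matrix.mem_orthogonalGroup_iff (Fin d) ℝ).mp hU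
  have hV' : V * Vᵀ = 1 := (Matrix.mem_orthogonalGroup_iff (Fin d) ℝ).mp hV
  refine ⟨U, V, hU', hV', s, fun i hi => ?_, hM⟩
  by_contra hne
  rw [hM, rank_orthogonal_mul_mul hU' hV', Matrix.rank_diagonal, Fintype.card_subtype] at hi
  have h1 : (Finset.univ.filter fun j : Fin d => (j : ℕ) < i + 1) ⊆
      Finset.univ.filter fun j => s j ≠ 0 := by
    intro j hj
    simp only [Finset.mem_filter, Finset.mem_univ, true_and] at hj ⊢
    have h2 : s i ≤ s j := hs (by rw [Fin.le_def]; omega)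
    have h3 : 0 < s i := lt_of_le_of_ne (hs0 i) (Ne.symm hne)
    linarith
  have h2 := Finset.card_le_card h1
  rw [card_filter_fin_lt (by omega)] at h2
  omega

theorem IsTruncatedSVD.rank_le {d r : ℕ} (hr : r ≤ d) {M B : Matrix (Fin d) (Fin d) ℝ}
    (h : IsTruncatedSVD r M B) : B.rank ≤ r := by
  obtain ⟨U, hU, V, hV, s, -, -, -, hB⟩ := h
  rw [hB, rank_orthogonal_mul_mul ((Matrix.mem_orthogonalGroup_iff (Fin d) ℝ).mp hU)
    ((Matrix.mem_orthogonalGroup_iff (Fin d) ℝ).mp hV), Matrix.rank_diagonal, Fintype.card_subtype]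
  conv_rhs => rw [← card_filter_fin_lt hr]
  refine Finset.card_le_card fun i hi => ?_
  simp only [Finset.mem_filter, Finset.mem_univ, true_and] at hi ⊢
  by_contra hcon
  simp [hcon] at hi

/-- The Eckart–Young theorem for the Frobenius norm. -/
theorem IsTruncatedSVD.frobNorm_sub_le {d r : ℕ} (h1r : 1 ≤ r) (hr : r ≤ d)
    {M B : Matrix (Fin d) (Fin d) ℝ} (h : IsTruncatedSVD r M B) {A : Matrix (Fin d) (Fin d) ℝ}
    (hA : A.rank ≤ r) : frobNorm (M - B) ^ 2 ≤ frobNorm (M - A) ^ 2 := by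
  obtain ⟨U, hU, V, hV, s, hs, hs0, hM, hB⟩ := h
  have hU1 : U * Uᵀ = 1 := (Matrix.mem_orthogonalGroup_iff (Fin d) ℝ).mp hU
  have hV1 : V * Vᵀ = 1 := (Matrix.mem_orthogonalGroup_iff (Fin d) ℝ).mp hV
  have hU2 : Uᵀ * U = 1 := mul_eq_one_comm.mp hU1
  have hV2 : Vᵀ * V = 1 := mul_eq_one_comm.mp hV1
  have hinv : ∀ N, frobNorm (U * N * Vᵀ) ^ 2 = frobNorm N ^ 2 := fun N => by
    rw [frobNorm_mul_orthogonal_sq (by rwa [Matrix.transpose_transpose]),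
      frobNorm_orthogonal_mul_sq hU2]
  have hA' : A = U * (Uᵀ * A * V) * Vᵀ := by
    rw [Matrix.mul_assoc Uᵀ, ← Matrix.mul_assoc, ← Matrix.mul_assoc, hU1, Matrix.one_mul,
      Matrix.mul_assoc, hV1, Matrix.mul_one]
  -- In the singular bases of `M` the competitor is `P diag(t) Qᵀ` with at most `r` nonzero `t`.
  -- After multiplication by `Pᵀ`, the rows of index at least `r` of the difference do not involve
  -- the competitor; they alone give the lower bound `hrow`, with weights `∑_{k < r} P i k ^ 2`.
  obtain ⟨P, Q, hP, hQ, t, ht, hPQ⟩ := exists_svd (Uᵀ * A * V)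
  have hrank : (Uᵀ * A * V).rank ≤ r := by
    rwa [← rank_orthogonal_mul_mul hU1 hV1, ← hA']
  obtain ⟨hw0, hw1, hw2⟩ := orthogonal_weights hP r
  have hweights := sum_mul_weight_le_of_antitone h1r hr (a := fun i => s i ^ 2)
    (fun i j hij => pow_le_pow_left₀ (hs0 j) (hs hij) 2) (fun i => sq_nonneg _) hw0 hw1 hw2
  have hleft : frobNorm (M - B) ^ 2 = ∑ i, s i ^ 2 - ∑ i : Fin d with i.val < r, s i ^ 2 := by
    rw [hM, hB, ← Matrix.sub_mul, ← Matrix.mul_sub, hinv, Matrix.diagonal_sub,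
      frobNorm_diagonal_sq, Finset.sum_filter, ← Finset.sum_sub_distrib]
    refine Finset.sum_congr rfl fun i _ => ?_
    split_ifs <;> simp
  have hright : frobNorm (M - A) ^ 2 =
      frobNorm (Pᵀ * Matrix.diagonal s - Matrix.diagonal t * Qᵀ) ^ 2 := by
    rw [← frobNorm_orthogonal_mul_sq (U := P) (mul_eq_one_comm.mp hP)
      (Pᵀ * Matrix.diagonal s - Matrix.diagonal t * Qᵀ), Matrix.mul_sub,
      ← Matrix.mul_assoc, hP, Matrix.one_mul, ← Matrix.mul_assoc, ← hPQ, ← hinv (Matrix.diagonal s - _), Matrix.mul_sub,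
      Matrix.sub_mul, ← hM, ← hA']
  have hrow : ∑ i, s i ^ 2 - ∑ i, s i ^ 2 * ∑ k : Fin d with k.val < r, P i k ^ 2 ≤
      frobNorm (M - A) ^ 2 := by
    have h1 : ∀ i, s i ^ 2 = ∑ k, s i ^ 2 * P i k ^ 2 := fun i => by
      have h := congrFun (congrFun hP i) i
      simp only [Matrix.mul_apply, Matrix.transpose_apply, Matrix.one_apply_eq, ← sq] at h
      rw [← Finset.mul_sum, h, mul_one]
    conv_lhs => enter [1, 2, i]; rw [h1 i]
    simp only [Finset.mul_sum, Finset.sum_filter]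
    rw [← Finset.sum_sub_distrib, hright, frobNorm_sq_eq_sum]
    simp only [← Finset.sum_sub_distrib]
    rw [Finset.sum_comm]
    refine Finset.sum_le_sum fun k _ => Finset.sum_le_sum fun i _ => ?_
    simp only [Matrix.sub_apply, Matrix.mul_diagonal, Matrix.diagonal_mul, Matrix.transpose_apply]
    split_ifs with hk
    · rw [sub_self]; positivity
    · rw [ht k (by omega)]
      apply le_of_eq; ring
  rw [hleft]
  linarith

/-- In a singular value decomposition of `D` the trace is a sum of at most `2r` products, to which
Cauchy–Schwarz is applied. The diagonal entries of `Vᵀ Eᵀ U` are bounded by duality between the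
norms of `Γ` and `Γ⁻¹`, and summing `v_iᵀ Γ⁻¹ v_i` over the columns `v_i` of `V` becomes a weighted
sum of the inverse eigenvalues. -/
theorem trace_transpose_mul_le {d r : ℕ} (h1r : 1 ≤ r) (hr : r ≤ d)
    {Γ : Matrix (Fin d) (Fin d) ℝ} (hΓ : Γ.IsHermitian) (hΓ1 : ∀ u, u ⬝ᵥ u ≤ quad Γ u)
    {E D : Matrix (Fin d) (Fin d) ℝ} {ε2 : ℝ}
    (hE : ∀ p, p ⬝ᵥ p ≤ 1 → quad Γ (Eᵀ *ᵥ p) ≤ ε2) (hD : D.rank ≤ 2 * r) :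
    (Eᵀ * D).trace ^ 2 ≤
      ε2 * (2 * ∑ i : Fin d with d - r ≤ i.val, 1 / sortedEig hΓ i) * frobNorm D ^ 2 := by
  obtain ⟨U, V, hU, hV, s, hs, hDs⟩ := exists_svd D
  obtain ⟨W, hW, hΓW⟩ := exists_orthogonal_diagonal_sortedEig hΓ
  have hW1 : W * Wᵀ = 1 := (Matrix.mem_orthogonalGroup_iff (Fin d) ℝ).mp hW
  have hW2 : Wᵀ * W = 1 := mul_eq_one_comm.mp hW1
  have hU2 : Uᵀ * U = 1 := mul_eq_one_comm.mp hU
  have hV2 : Vᵀ * V = 1 := mul_eq_one_comm.mp hV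
  have hl := one_le_sortedEig hΓ hΓ1
  set l := sortedEig hΓ with hldef
  have hl0 : ∀ i, 0 < l i := fun i => by linarith [hl i]
  have hε : 0 ≤ ε2 := by simpa [quad] using hE 0 (by simp)
  let F : Matrix (Fin d) (Fin d) ℝ := Vᵀ * Eᵀ * U
  let Q : Matrix (Fin d) (Fin d) ℝ := Wᵀ * V
  have hQ : Q * Qᵀ = 1 := by
    simp only [Q, Matrix.transpose_mul, Matrix.transpose_transpose]
    rw [Matrix.mul_assoc, ← Matrix.mul_assoc V, hV, Matrix.one_mul, hW2]
  have htr : (Eᵀ * D).trace = ∑ i : Fin d with i.val < 2 * r, F i i * s i := by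
    rw [hDs, ← Matrix.mul_assoc, Matrix.trace_mul_comm, ← Matrix.mul_assoc, ← Matrix.mul_assoc]
    simp only [Matrix.trace, Matrix.diag, Matrix.mul_diagonal, Finset.sum_filter]
    refine Finset.sum_congr rfl fun i _ => ?_
    split_ifs with hi
    · rfl
    · rw [hs i (by omega), mul_zero]
  have hDn : ∑ i : Fin d with i.val < 2 * r, s i ^ 2 ≤ frobNorm D ^ 2 := by
    rw [hDs, frobNorm_mul_orthogonal_sq (by rwa [Matrix.transpose_transpose]),
      frobNorm_orthogonal_mul_sq hU2, frobNorm_diagonal_sq]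
    exact Finset.sum_le_sum_of_subset_of_nonneg (Finset.filter_subset _ _)
      fun _ _ _ => sq_nonneg _
  have hF : ∀ i, F i i ^ 2 ≤ ε2 * ∑ k, 1 / l k * Q k i ^ 2 := by
    intro i
    let z := Eᵀ *ᵥ (U *ᵥ Pi.single i 1)
    have hz : quad Γ z ≤ ε2 := hE _ (by
      rw [← quad_transpose_mul_self, hU2, quad_one]; simp)
    have hFi : F i i = ∑ k, Q k i * (Wᵀ *ᵥ z) k := by
      have h1 : F = Qᵀ * (Wᵀ * (Eᵀ * U)) := by
        simp only [F, Q, Matrix.transpose_mul, Matrix.transpose_transpose]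
        rw [← Matrix.mul_assoc, Matrix.mul_assoc Vᵀ W, hW1, Matrix.mul_one, Matrix.mul_assoc]
      rw [h1, Matrix.mul_apply]
      refine Finset.sum_congr rfl fun k _ => ?_
      simp only [z, Matrix.transpose_apply, Matrix.mulVec_mulVec, Matrix.mulVec_single_one]
      rfl
    -- In the eigenbasis of `Γ`, the weights `√(l k)` split `⟨v_i, z⟩` into a `Γ⁻¹`-norm of `v_i`
    -- and a `Γ`-norm of `z`.
    have hcs := Finset.sum_mul_sq_le_sq_mul_sq Finset.univ (fun k => Q k i / √(l k))
      (fun k => √(l k) * (Wᵀ *ᵥ z) k)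
    have e1 : ∀ k, Q k i / √(l k) * (√(l k) * (Wᵀ *ᵥ z) k) = Q k i * (Wᵀ *ᵥ z) k := fun k => by
      have := (Real.sqrt_pos.mpr (hl0 k)).ne'
      field_simp
    have e2 : ∀ k, (Q k i / √(l k)) ^ 2 = 1 / l k * Q k i ^ 2 := fun k => by
      rw [div_pow, Real.sq_sqrt (hl0 k).le]; ring
    have e3 : ∀ k, (√(l k) * (Wᵀ *ᵥ z) k) ^ 2 = l k * (Wᵀ *ᵥ z) k ^ 2 := fun k => by
      rw [mul_pow, Real.sq_sqrt (hl0 k).le]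
    simp only [e1, e2, e3] at hcs
    rw [← hFi, ← quad_eq_sum_of_eq hΓW] at hcs
    refine hcs.trans ?_
    rw [mul_comm]
    refine mul_le_mul_of_nonneg_right hz (Finset.sum_nonneg fun k _ => ?_)
    have := hl0 k
    positivity
  obtain ⟨hw0, hw1, hw2⟩ := orthogonal_weights hQ (2 * r)
  have hanti : Antitone l := fun i j hij => hΓ.eigenvalues₀_antitone hij
  have hmono : Monotone fun i => 1 / l i := fun i j hij =>
    one_div_le_one_div_of_le (hl0 j) (hanti hij)
  have hweights := sum_mul_weight_le_of_monotone h1r hr hmono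
    (fun i => (one_div_pos.mpr (hl0 i)).le) hw0 hw1 (by exact_mod_cast hw2)
  have hFsum : ∑ i : Fin d with i.val < 2 * r, F i i ^ 2 ≤
      ε2 * (2 * ∑ i : Fin d with d - r ≤ i.val, 1 / l i) := by
    refine (Finset.sum_le_sum fun i _ => hF i).trans ?_
    rw [← Finset.mul_sum, Finset.sum_comm]
    simp only [← Finset.mul_sum]
    exact mul_le_mul_of_nonneg_left hweights hε
  rw [htr]
  refine (Finset.sum_mul_sq_le_sq_mul_sq _ _ _).trans ?_
  exact mul_le_mul hFsum hDn (Finset.sum_nonneg fun _ _ => sq_nonneg _)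
    ((Finset.sum_nonneg fun _ _ => sq_nonneg _).trans hFsum)

/-- Truncation turns an error `E = M - A` of the initial estimate, measured by `E Γ Eᵀ`, into a
Frobenius norm error governed by the harmonic mean of the smallest eigenvalues of `Γ`. -/
theorem IsTruncatedSVD.frobNorm_sub_sq_le {d r : ℕ} (h1r : 1 ≤ r) (hr : r ≤ d)
    {Γ : Matrix (Fin d) (Fin d) ℝ} (hΓ : Γ.IsHermitian) (hΓ1 : ∀ u, u ⬝ᵥ u ≤ quad Γ u)
    {M A B : Matrix (Fin d) (Fin d) ℝ} (hB : IsTruncatedSVD r M B) (hA : A.rank ≤ r) {ε2 : ℝ}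
    (hE : ∀ p, p ⬝ᵥ p ≤ 1 → quad Γ ((M - A)ᵀ *ᵥ p) ≤ ε2) :
    frobNorm (B - A) ^ 2 ≤ 8 * ε2 * (r / harmonicEig r hΓ) := by
  have h1 := hB.frobNorm_sub_le h1r hr hA
  have hrank : (B - A).rank ≤ 2 * r := by
    have := rank_sub_le B A
    have := hB.rank_le hr
    omega
  have h2 := trace_transpose_mul_le h1r hr hΓ hΓ1 hE hrank
  -- Expanding `‖E - D‖² ≤ ‖E‖²` leaves `x ≤ 2 y`; together with `y² ≤ 2 ε2 T x` this gives `x² ≤ 8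
  -- ε2 T x`.
  rw [show M - B = (M - A) - (B - A) by abel, frobNorm_sub_sq] at h1
  have hr0 : (r : ℝ) ≠ 0 := by positivity
  have hH : (r : ℝ) / harmonicEig r hΓ = ∑ i : Fin d with d - r ≤ i.val, 1 / sortedEig hΓ i := by
    rw [harmonicEig, div_inv_eq_mul]
    field_simp
  rw [hH]
  set x := frobNorm (B - A) ^ 2
  set y := ((M - A)ᵀ * (B - A)).trace
  set T := ∑ i : Fin d with d - r ≤ i.val, 1 / sortedEig hΓ i
  have hx : 0 ≤ x := sq_nonneg _
  have hxy : x ≤ 2 * y := by linarith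
  by_contra! hcon
  rcases hx.eq_or_lt with hx0 | hx0
  · have hε : 0 ≤ ε2 := by simpa [quad] using hE 0 (by simp)
    have hT : 0 ≤ T := Finset.sum_nonneg fun i _ => by
      have := one_le_sortedEig hΓ hΓ1 i
      positivity
    have : 0 ≤ 8 * ε2 * T := by positivity
    linarith
  · nlinarith

/-! ### Least squares -/

/-- The normal equations. -/
theorem IsLeastSquares.normal_equations {n d : ℕ} {X Y : Matrix (Fin n) (Fin d) ℝ}
    {B : Matrix (Fin d) (Fin d) ℝ} (h : IsLeastSquares X Y B) : Xᵀ * (Y - X * Bᵀ) = 0 := by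
  set R := Y - X * Bᵀ with hR
  set H := Xᵀ * R with hH
  -- Optimality of `B` against the perturbation `B + t Hᵀ`, where `H` is the residual correlation to
  -- be shown zero.
  have key : ∀ t : ℝ, 0 ≤ t ^ 2 * frobNorm (X * H) ^ 2 - 2 * t * frobNorm H ^ 2 := by
    intro t
    have h1 := h (B + t • Hᵀ)
    have h2 : Y - X * (B + t • Hᵀ)ᵀ = R - X * (t • H) := by
      rw [hR, Matrix.transpose_add, Matrix.transpose_smul, Matrix.transpose_transpose,
        Matrix.mul_add]
      abel
    rw [h2] at h1
    have h3 := pow_le_pow_left₀ (frobNorm_nonneg _) h1 2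
    rw [frobNorm_sub_sq R] at h3
    have h4 : (Rᵀ * (X * (t • H))).trace = t * frobNorm H ^ 2 := by
      rw [frobNorm_sq, ← Matrix.mul_assoc, Matrix.mul_smul, Matrix.trace_smul, smul_eq_mul]
      congr 3
      rw [hH, Matrix.transpose_mul, Matrix.transpose_transpose]
    have h5 : frobNorm (X * (t • H)) ^ 2 = t ^ 2 * frobNorm (X * H) ^ 2 := by
      simp only [frobNorm_sq, Matrix.mul_smul, Matrix.transpose_smul, Matrix.smul_mul,
        Matrix.trace_smul, smul_eq_mul]
      ring
    rw [h4, h5] at h3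
    linarith
  have h0 : frobNorm H ^ 2 = 0 := by
    by_contra hne
    have hpos : 0 < frobNorm H ^ 2 := lt_of_le_of_ne (sq_nonneg _) (Ne.symm hne)
    have hb : 0 ≤ frobNorm (X * H) ^ 2 := sq_nonneg _
    -- This is nearly the minimiser of the quadratic in `t`; the `+ 1` avoids division by zero when
    -- `X H = 0`.
    have := key (frobNorm H ^ 2 / (frobNorm (X * H) ^ 2 + 1))
    rw [div_pow, div_mul_eq_mul_div, mul_div_assoc', div_mul_eq_mul_div, div_sub_div _ _
      (by positivity) (by positivity)] at this
    have h6 : 0 < (frobNorm (X * H) ^ 2 + 1) ^ 2 * (frobNorm (X * H) ^ 2 + 1) := by positivity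
    rw [le_div_iff₀ h6] at this
    nlinarith [mul_pos hpos hpos, mul_pos (mul_pos hpos hpos)
      (show 0 < frobNorm (X * H) ^ 2 + 1 by linarith)]
  rw [frobNorm_sq_eq_sum] at h0
  ext i j
  have h1 := (Finset.sum_eq_zero_iff_of_nonneg
    fun i _ => Finset.sum_nonneg fun j _ => sq_nonneg (H i j)).mp h0 i (Finset.mem_univ i)
  have h2 := (Finset.sum_eq_zero_iff_of_nonneg
    fun j _ => sq_nonneg (H i j)).mp h1 j (Finset.mem_univ j)
  exact pow_eq_zero_iff two_ne_zero |>.mp h2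

/-! ### Exponential moments of squares of subgaussian variables -/

theorem lintegral_exp_quarter_sq_gaussianReal :
    ∫⁻ g, ENNReal.ofReal (Real.exp (g ^ 2 / 4)) ∂(gaussianReal 0 1) = ENNReal.ofReal √2 := by
  have h1 : ∀ g : ℝ, gaussianPDFReal 0 1 g * Real.exp (g ^ 2 / 4) =
      (√(2 * Real.pi))⁻¹ * Real.exp (-(1 / 4) * g ^ 2) := fun g => by
    rw [gaussianPDFReal, mul_assoc, ← Real.exp_add]
    simp only [NNReal.coe_one, mul_one, sub_zero]
    congr 2
    ring
  have hint : Integrable (fun g : ℝ => gaussianPDFReal 0 1 g * Real.exp (g ^ 2 / 4)) := by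
    simp only [h1]
    exact (integrable_exp_neg_mul_sq (by norm_num : (0 : ℝ) < 1 / 4)).const_mul _
  rw [gaussianReal_of_var_ne_zero _ one_ne_zero,
    lintegral_withDensity_eq_lintegral_mul _ (measurable_gaussianPDF 0 1) (by fun_prop)]
  have h2 : ∀ g, (gaussianPDF 0 1 * fun g => ENNReal.ofReal (Real.exp (g ^ 2 / 4))) g =
      ENNReal.ofReal (gaussianPDFReal 0 1 g * Real.exp (g ^ 2 / 4)) := fun g => by
    rw [Pi.mul_apply, gaussianPDF, ENNReal.ofReal_mul (gaussianPDFReal_nonneg 0 1 g)]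
  simp only [h2]
  rw [← ofReal_integral_eq_lintegral_ofReal hint
    (ae_of_all _ fun g => mul_nonneg (gaussianPDFReal_nonneg 0 1 g) (Real.exp_nonneg _))]
  simp only [h1]
  rw [integral_const_mul, integral_gaussian]
  congr 1
  rw [← Real.sqrt_inv, ← Real.sqrt_mul (by positivity)]
  congr 1
  have := Real.pi_pos.ne'
  field_simp
  norm_num

section Subgaussian

variable {Ω : Type*} [MeasurableSpace Ω] {μ : Measure Ω}

theorem ProbabilityTheory.HasSubgaussianMGF.lintegral_exp_mul_le {X : Ω → ℝ} {τ : ℝ≥0}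
    (h : HasSubgaussianMGF X τ μ) (t : ℝ) :
    ∫⁻ ω, ENNReal.ofReal (Real.exp (t * X ω)) ∂μ ≤ ENNReal.ofReal (Real.exp (τ * t ^ 2 / 2)) := by
  rw [← ofReal_integral_eq_lintegral_ofReal (h.integrable_exp_mul t)
    (ae_of_all _ fun _ => (Real.exp_nonneg _))]
  exact ENNReal.ofReal_le_ofReal (h.mgf_le t)

/-- Gaussian linearisation: `exp (b x²)` is the mean of `exp (√(2b) x g)` over a standard Gaussian
`g`. Exchanging the integrals and using the subgaussian bound in `X` leaves at most the mean of `exp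
(g² / 4)`, which is `√2`. -/
theorem ProbabilityTheory.HasSubgaussianMGF.lintegral_exp_sq_le [IsProbabilityMeasure μ]
    {X : Ω → ℝ} {τ : ℝ≥0} (h : HasSubgaussianMGF X τ μ) (hX : Measurable X) {b : ℝ} (hb : 0 ≤ b)
    (hbτ : b * τ ≤ 1 / 4) :
    ∫⁻ ω, ENNReal.ofReal (Real.exp (b * X ω ^ 2)) ∂μ ≤ ENNReal.ofReal √2 := by
  have h1 : ∀ ω, ENNReal.ofReal (Real.exp (b * X ω ^ 2)) =
      ∫⁻ g, ENNReal.ofReal (Real.exp (√(2 * b) * X ω * g)) ∂(gaussianReal 0 1) := fun ω => by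
    rw [← ofReal_integral_eq_lintegral_ofReal (integrable_exp_mul_gaussianReal _)
      (ae_of_all _ fun _ => (Real.exp_nonneg _))]
    have := congrFun (mgf_fun_id_gaussianReal (μ := 0) (v := 1)) (√(2 * b) * X ω)
    rw [mgf] at this
    rw [this]
    congr 2
    rw [mul_pow, Real.sq_sqrt (by linarith)]
    simp
    ring
  simp only [h1]
  rw [lintegral_lintegral_swap (by fun_prop), ← lintegral_exp_quarter_sq_gaussianReal]
  refine lintegral_mono fun g => ?_
  have h2 : ∀ ω, √(2 * b) * X ω * g = (√(2 * b) * g) * X ω := fun ω => by ring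
  simp only [h2]
  refine (h.lintegral_exp_mul_le _).trans (ENNReal.ofReal_le_ofReal (Real.exp_le_exp.mpr ?_))
  rw [mul_pow, Real.sq_sqrt (by linarith)]
  nlinarith [sq_nonneg g]

theorem ProbabilityTheory.HasSubgaussianMGF.integrable_exp_sq [IsProbabilityMeasure μ]
    {X : Ω → ℝ} {τ : ℝ≥0} (h : HasSubgaussianMGF X τ μ) (hX : Measurable X) {b : ℝ} (hb : 0 ≤ b)
    (hbτ : b * τ ≤ 1 / 4) :
    Integrable (fun ω => Real.exp (b * X ω ^ 2)) μ ∧ ∫ ω, Real.exp (b * X ω ^ 2) ∂μ ≤ 3 / 2 := by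
  have h1 := h.lintegral_exp_sq_le hX hb hbτ
  have hint : Integrable (fun ω => Real.exp (b * X ω ^ 2)) μ := by
    refine ⟨by fun_prop, ?_⟩
    rw [hasFiniteIntegral_iff_ofReal (ae_of_all _ fun _ => (Real.exp_nonneg _))]
    exact h1.trans_lt ENNReal.ofReal_lt_top
  refine ⟨hint, ?_⟩
  rw [← ofReal_integral_eq_lintegral_ofReal hint (ae_of_all _ fun _ => (Real.exp_nonneg _)),
    ENNReal.ofReal_le_ofReal_iff (Real.sqrt_nonneg _)] at h1
  refine h1.trans ?_
  rw [Real.sqrt_le_left (by norm_num)]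
  norm_num

/-- Comparison of `1 + x ≤ exp x` at `x = X² / (4τ)` with the exponential moment `3/2`; the sharp
constant is not needed. -/
theorem ProbabilityTheory.HasSubgaussianMGF.integral_sq_le [IsProbabilityMeasure μ]
    {X : Ω → ℝ} {τ : ℝ≥0} (h : HasSubgaussianMGF X τ μ) (hX : Measurable X) (hτ : 0 < τ) :
    ∫ ω, X ω ^ 2 ∂μ ≤ 2 * τ := by
  have hτ' : (0 : ℝ) < τ := hτ
  obtain ⟨hint, hle⟩ := h.integrable_exp_sq hX (b := 1 / (4 * τ)) (by positivity)
    (by field_simp; norm_num)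
  have h2 : Integrable (fun ω => X ω ^ 2) μ := (h.memLp 2).integrable_sq
  have h3 : ∫ ω, (1 + 1 / (4 * τ) * X ω ^ 2) ∂μ ≤ ∫ ω, Real.exp (1 / (4 * τ) * X ω ^ 2) ∂μ :=
    integral_mono ((integrable_const _).add (h2.const_mul _)) hint fun ω => by
      simpa [add_comm] using Real.add_one_le_exp (1 / (4 * (τ : ℝ)) * X ω ^ 2)
  rw [integral_add (integrable_const _) (h2.const_mul _), integral_const_mul] at h3
  simp only [integral_const, probReal_univ, one_smul] at h3
  have h4 : 1 / (4 * (τ : ℝ)) * ∫ ω, X ω ^ 2 ∂μ ≤ 1 / 2 := by linarith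
  rw [div_mul_eq_mul_div, one_mul, div_le_iff₀ (by positivity)] at h4
  linarith

/-- Second-order Taylor bound with remainder `(s y)² exp |s y|`. Half of the exponent `|y|` pays for
`exp |s y|`, the other half for `y² ≤ 8 exp (|y| / 2)`. -/
theorem exp_mul_le_of_abs_le {s y : ℝ} (hs : |s| ≤ 1 / 2) :
    Real.exp (s * y) ≤ 1 + s * y + 8 * s ^ 2 * Real.exp |y| := by
  have h1 := Complex.norm_exp_sub_sum_le_norm_mul_exp ((s * y : ℝ) : ℂ) 2
  rw [Complex.norm_real, Real.norm_eq_abs, ← Complex.ofReal_exp] at h1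
  simp only [Finset.sum_range_succ, Finset.sum_range_zero, pow_zero, pow_one, Nat.factorial,
    Nat.cast_one, div_one, zero_add, mul_one] at h1
  rw [← Complex.ofReal_one, ← Complex.ofReal_add, ← Complex.ofReal_sub, Complex.norm_real,
    Real.norm_eq_abs, sq_abs] at h1
  have h2 : |s * y| ≤ |y| / 2 := by
    rw [abs_mul]; nlinarith [abs_nonneg y]
  have h3 : Real.exp |s * y| ≤ Real.exp (|y| / 2) := Real.exp_le_exp.mpr h2
  have h4 := Real.quadratic_le_exp_of_nonneg (x := |y| / 2) (by positivity)
  have h5 : y ^ 2 ≤ 8 * Real.exp (|y| / 2) := by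
    rw [div_pow, sq_abs] at h4; nlinarith [abs_nonneg y]
  have h6 : Real.exp |y| = Real.exp (|y| / 2) * Real.exp (|y| / 2) := by
    rw [← Real.exp_add]; ring_nf
  have h7 : y ^ 2 * Real.exp |s * y| ≤ 8 * Real.exp (|y| / 2) * Real.exp (|y| / 2) :=
    mul_le_mul h5 h3 (Real.exp_nonneg _) (by positivity)
  have h8 : (s * y) ^ 2 * Real.exp |s * y| ≤ 8 * s ^ 2 * Real.exp |y| := by
    rw [h6]; nlinarith [sq_nonneg s]
  linarith [le_abs_self (Real.exp (s * y) - (1 + s * y))]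

/-- Centred squares of subgaussian variables are subexponential. -/
theorem ProbabilityTheory.HasSubgaussianMGF.integral_exp_sq_sub_le [IsProbabilityMeasure μ]
    {X : Ω → ℝ} {τ : ℝ≥0} (h : HasSubgaussianMGF X τ μ) (hX : Measurable X) (hτ : 0 < τ) {m : ℝ}
    (hm : ∫ ω, X ω ^ 2 ∂μ = m) {t : ℝ} (ht : |t| * τ ≤ 1 / 8) :
    Integrable (fun ω => Real.exp (t * (X ω ^ 2 - m))) μ ∧
      ∫ ω, Real.exp (t * (X ω ^ 2 - m)) ∂μ ≤ Real.exp (384 * τ ^ 2 * t ^ 2) := by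
  have hτ' : (0 : ℝ) < τ := hτ
  -- `a` is the largest scale at which `exp (a X²)` is controlled, and `t = s a` with `|s| ≤ 1/2`.
  -- The remainder is at most `16 s² · 3/2 = 24 (4 τ t)² = 384 τ² t²`.
  set a : ℝ := 1 / (4 * τ) with ha
  have ha0 : 0 < a := by positivity
  set s : ℝ := 4 * τ * t with hs
  have hsa : s * a = t := by rw [hs, ha]; field_simp
  have hs2 : |s| ≤ 1 / 2 := by
    rw [hs, abs_mul, abs_of_pos (by positivity : (0 : ℝ) < 4 * τ)]; linarith
  obtain ⟨hint, hle⟩ := h.integrable_exp_sq hX (b := a) ha0.le (by rw [ha]; field_simp; norm_num)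
  have hm0 : 0 ≤ m := hm ▸ integral_nonneg fun ω => sq_nonneg _
  have ham : a * m ≤ 1 / 2 := by
    have := h.integral_sq_le hX hτ
    rw [hm] at this
    rw [ha, div_mul_eq_mul_div, div_le_iff₀ (by positivity)]
    linarith
  have hexp : Real.exp (a * m) ≤ 2 := by
    have h1 : Real.exp (a * m) ≤ Real.exp (1 / 2) := Real.exp_le_exp.mpr ham
    have h2 : Real.exp (1 / 2) * Real.exp (1 / 2) = Real.exp 1 := by
      rw [← Real.exp_add]; norm_num
    nlinarith [Real.exp_one_lt_d9, Real.exp_pos (1 / 2)]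
  have hpt : ∀ ω, Real.exp (t * (X ω ^ 2 - m)) ≤
      1 + t * (X ω ^ 2 - m) + 16 * s ^ 2 * Real.exp (a * X ω ^ 2) := fun ω => by
    have h1 := exp_mul_le_of_abs_le (y := a * (X ω ^ 2 - m)) hs2
    rw [← mul_assoc, hsa] at h1
    have h2 : Real.exp |a * (X ω ^ 2 - m)| ≤ Real.exp (a * X ω ^ 2) * 2 := by
      refine le_trans ?_ (mul_le_mul_of_nonneg_left hexp (Real.exp_nonneg _))
      rw [← Real.exp_add]
      refine Real.exp_le_exp.mpr (abs_le.mpr ⟨?_, ?_⟩) <;>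
        nlinarith [sq_nonneg (X ω), mul_nonneg ha0.le hm0, mul_nonneg ha0.le (sq_nonneg (X ω))]
    nlinarith [sq_nonneg s]
  have h2 : Integrable (fun ω => X ω ^ 2) μ := (h.memLp 2).integrable_sq
  have h3 : Integrable (fun ω => t * (X ω ^ 2 - m)) μ := (h2.sub (integrable_const _)).const_mul _
  have h1 : Integrable (fun ω => 1 + t * (X ω ^ 2 - m)) μ := (integrable_const _).add h3
  have hR : Integrable (fun ω =>
      1 + t * (X ω ^ 2 - m) + 16 * s ^ 2 * Real.exp (a * X ω ^ 2)) μ :=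
    h1.add (hint.const_mul _)
  have hL : Integrable (fun ω => Real.exp (t * (X ω ^ 2 - m))) μ := by
    refine hR.mono' (by fun_prop) (ae_of_all _ fun ω => ?_)
    rw [Real.norm_eq_abs, abs_of_pos (Real.exp_pos _)]
    exact hpt ω
  refine ⟨hL, (integral_mono hL hR hpt).trans ?_⟩
  rw [integral_add h1 (hint.const_mul _),
    integral_add (integrable_const _) h3, integral_const_mul, integral_const_mul,
    integral_sub h2 (integrable_const _), hm]
  simp only [integral_const, probReal_univ, one_smul, sub_self, mul_zero, add_zero]
  have h4 : 16 * s ^ 2 * ∫ ω, Real.exp (a * X ω ^ 2) ∂μ ≤ 384 * τ ^ 2 * t ^ 2 := by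
    have : 16 * s ^ 2 * ∫ ω, Real.exp (a * X ω ^ 2) ∂μ ≤ 16 * s ^ 2 * (3 / 2) := by gcongr
    rw [hs] at this ⊢
    linarith
  linarith [Real.add_one_le_exp (384 * (τ : ℝ) ^ 2 * t ^ 2)]

/-- Markov's inequality for `exp Z`. -/
theorem measure_le_of_lintegral_exp_le_one {Z : Ω → ℝ} (hZ : Measurable Z)
    (h : ∫⁻ ω, ENNReal.ofReal (Real.exp (Z ω)) ∂μ ≤ 1) (K : ℝ) :
    μ {ω | K ≤ Z ω} ≤ ENNReal.ofReal (Real.exp (-K)) := by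
  have h1 := meas_ge_le_lintegral_div (μ := μ) (f := fun ω => ENNReal.ofReal (Real.exp (Z ω)))
    (by fun_prop) (ε := ENNReal.ofReal (Real.exp K)) (by simp [Real.exp_pos]) (by simp)
  have h2 : {ω | K ≤ Z ω} ⊆ {ω | ENNReal.ofReal (Real.exp K) ≤ ENNReal.ofReal (Real.exp (Z ω))} :=
    fun ω hω => ENNReal.ofReal_le_ofReal (Real.exp_le_exp.mpr hω)
  refine (measure_mono h2).trans (h1.trans ?_)
  rw [Real.exp_neg, ENNReal.ofReal_inv_of_pos (Real.exp_pos K), ENNReal.div_eq_inv_mul]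
  exact mul_le_of_le_one_right' h

/-- A one-sided tail bound for sums of centred squares; the sign of `t` selects the side. -/
theorem measure_sum_sq_sub_ge_le [IsProbabilityMeasure μ] {X : ℕ → Ω → ℝ} {τ : ℝ≥0}
    (hind : iIndepFun X μ) (hsub : ∀ i, HasSubgaussianMGF (X i) τ μ) (hX : ∀ i, Measurable (X i))
    (hτ : 0 < τ) {m : ℝ} (hm : ∀ i, ∫ ω, X i ω ^ 2 ∂μ = m) {t : ℝ} (ht : |t| * τ ≤ 1 / 8)
    (n : ℕ) (K : ℝ) :
    μ {ω | K ≤ t * ∑ i ∈ Finset.range n, (X i ω ^ 2 - m) - n * (384 * τ ^ 2 * t ^ 2)} ≤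
      ENNReal.ofReal (Real.exp (-K)) := by
  refine measure_le_of_lintegral_exp_le_one (by fun_prop) ?_ K
  let Y : ℕ → Ω → ℝ := fun i ω => X i ω ^ 2 - m
  have hY : iIndepFun Y μ := hind.comp (fun _ x => x ^ 2 - m) fun _ => by fun_prop
  have hYm : ∀ i, Measurable (Y i) := fun i => by fun_prop
  have hmgf := hY.mgf_sum (t := t) hYm (Finset.range n)
  have hint := hY.integrable_exp_mul_sum (t := t) hYm (s := Finset.range n)
    fun i _ => ((hsub i).integral_exp_sq_sub_le (hX i) hτ (hm i) ht).1
  have hle : ∫ ω, Real.exp (t * (∑ i ∈ Finset.range n, Y i) ω) ∂μ ≤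
      Real.exp (n * (384 * τ ^ 2 * t ^ 2)) := by
    rw [mgf] at hmgf
    rw [hmgf, Real.exp_nat_mul]
    refine (Finset.prod_le_prod (fun i _ => mgf_nonneg) fun i _ =>
      ((hsub i).integral_exp_sq_sub_le (hX i) hτ (hm i) ht).2).trans ?_
    simp
  simp only [Finset.sum_apply] at hint hle
  simp only [Real.exp_sub, div_eq_mul_inv, Y] at hint hle ⊢
  rw [← ofReal_integral_eq_lintegral_ofReal (hint.mul_const _)
    (ae_of_all _ fun _ => by positivity), integral_mul_const, ← ENNReal.ofReal_one]
  refine ENNReal.ofReal_le_ofReal ?_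
  rw [← div_eq_mul_inv]
  exact div_le_one_of_le₀ hle (Real.exp_nonneg _)

end Subgaussian

/-! ### The state process -/

theorem ltiState_congr {d : ℕ} (A : Matrix (Fin d) (Fin d) ℝ) {w w' : ℕ → Fin d → ℝ} {m : ℕ}
    (h : ∀ i < m, w i = w' i) : ltiState A w m = ltiState A w' m := by
  induction m with
  | zero => rfl
  | succ m ih =>
    simp only [ltiState]
    rw [ih fun i hi => h i (by omega), h m (by omega)]

theorem measurable_ltiState {d : ℕ} (A : Matrix (Fin d) (Fin d) ℝ) (m : ℕ) :
    Measurable fun w : ℕ → Fin d → ℝ => ltiState A w m := by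
  induction m with
  | zero => exact measurable_const
  | succ m ih =>
    simp only [ltiState]
    have hc : Continuous fun x : Fin d → ℝ => A *ᵥ x := by fun_prop
    exact (hc.measurable.comp ih).add (measurable_pi_apply m)

section Past

variable {Ω : Type*} [MeasurableSpace Ω] {μ : Measure Ω} {E ζ : Type*} [MeasurableSpace E]
  [MeasurableSpace ζ] {η : ℕ → Ω → E}

/-- A function of the first `m` noise vectors is independent of the next one. -/
theorem ProbabilityTheory.iIndepFun.indepFun_past [Zero E] (hind : iIndepFun η μ)
    (hη : ∀ i, Measurable (η i)) {m : ℕ} {G : (ℕ → E) → ζ} (hG : Measurable G)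
    (hGm : ∀ w w', (∀ i < m, w i = w' i) → G w = G w') :
    IndepFun (fun ω => G fun i => η i ω) (η m) μ := by
  classical
  have h := hind.indepFun_finset (Finset.range m) {m} (by simp) hη
  -- Padding the first `m` values by zero exhibits `G` as a measurable function of a finite block of
  -- the family; `hGm` makes the padding invisible.
  let ext : (Finset.range m → E) → ℕ → E :=
    fun y i => if h : i ∈ Finset.range m then y ⟨i, h⟩ else 0
  have hext : Measurable ext := by
    refine measurable_pi_lambda _ fun i => ?_
    by_cases hi : i ∈ Finset.range m
    · simp only [ext, hi, dite_true]; exact measurable_pi_apply _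
    · simp only [ext, hi, dite_false]; exact measurable_const
  have hψ : Measurable fun y : (({m} : Finset ℕ) → E) => y ⟨m, Finset.mem_singleton_self m⟩ :=
    measurable_pi_apply _
  have h2 := h.comp (φ := fun y => G (ext y))
    (ψ := fun y : (({m} : Finset ℕ) → E) => y ⟨m, Finset.mem_singleton_self m⟩) (hG.comp hext) hψ
  have e1 : (fun y => G (ext y)) ∘ (fun ω (i : Finset.range m) => η i ω) =
      fun ω => G fun i => η i ω := by
    funext ω
    refine hGm _ _ fun i hi => ?_
    simp [ext, hi]
  rw [e1] at h2
  exact h2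

/-- One supermartingale step, with Fubini for the product law in place of conditional expectation.
-/
theorem lintegral_mul_le_of_indepFun [IsProbabilityMeasure μ] {P : Ω → ζ} {Y : Ω → E}
    (hP : Measurable P) (hY : Measurable Y) (hind : IndepFun P Y μ) {f : ζ → ℝ≥0∞}
    (hf : Measurable f) {g : ζ → E → ℝ≥0∞} (hg : Measurable (Function.uncurry g))
    (h : ∀ x, ∫⁻ ω, g x (Y ω) ∂μ ≤ 1) :
    ∫⁻ ω, f (P ω) * g (P ω) (Y ω) ∂μ ≤ ∫⁻ ω, f (P ω) ∂μ := by
  have hF : Measurable fun z : ζ × E => f z.1 * g z.1 z.2 := (hf.comp measurable_fst).mul hg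
  have hprod := hind.map_prod_eq_prod_map_map hP.aemeasurable hY.aemeasurable
  have : IsProbabilityMeasure (μ.map Y) := Measure.isProbabilityMeasure_map hY.aemeasurable
  have h1 : ∫⁻ ω, f (P ω) * g (P ω) (Y ω) ∂μ =
      ∫⁻ z, f z.1 * g z.1 z.2 ∂((μ.map P).prod (μ.map Y)) := by
    rw [← hprod, lintegral_map hF (hP.prodMk hY)]
  rw [h1, lintegral_prod _ hF.aemeasurable, ← lintegral_map hf hP]
  refine lintegral_mono fun x => ?_
  have hgx : Measurable (g x) := hg.comp measurable_prodMk_left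
  simp only
  rw [lintegral_const_mul _ hgx, lintegral_map hgx hY]
  exact mul_le_of_le_one_right' (h x)

end Past

section StateProcess

variable {Ω : Type*} [MeasurableSpace Ω] {μ : Measure Ω} {d : ℕ} {η : ℕ → Ω → Fin d → ℝ}

/-- Homogeneity extends the bound from unit vectors to all vectors; the zero vector is treated
apart. -/
theorem hasSubgaussianMGF_dotProduct {ξ : Ω → Fin d → ℝ} [IsProbabilityMeasure μ] {σ : ℝ≥0}
    (h : ∀ u : Fin d → ℝ, u ⬝ᵥ u = 1 → HasSubgaussianMGF (fun ω => u ⬝ᵥ ξ ω) (σ ^ 2) μ)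
    {τ : ℝ≥0} (u : Fin d → ℝ) (hτ : (σ : ℝ) ^ 2 * (u ⬝ᵥ u) ≤ τ) :
    HasSubgaussianMGF (fun ω => u ⬝ᵥ ξ ω) τ μ := by
  rcases (dotProduct_self_nonneg' u).eq_or_lt with h0 | h0
  · have hu : u = 0 := dotProduct_self_eq_zero.mp h0.symm
    subst hu
    simp only [zero_dotProduct]
    refine ⟨fun t => by simp, fun t => ?_⟩
    simp only [mgf, mul_zero, Real.exp_zero, integral_const, probReal_univ, smul_eq_mul, mul_one]
    exact Real.one_le_exp (by positivity)
  · set c := √(u ⬝ᵥ u) with hc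
    have hc0 : 0 < c := Real.sqrt_pos.mpr h0
    have hcc : c * c = u ⬝ᵥ u := Real.mul_self_sqrt h0.le
    have hv : (c⁻¹ • u) ⬝ᵥ (c⁻¹ • u) = 1 := by
      rw [smul_dotProduct, dotProduct_smul, smul_eq_mul, smul_eq_mul, ← hcc]
      field_simp
    have h1 := h _ hv
    have h2 : ∀ t ω, t * (u ⬝ᵥ ξ ω) = (t * c) * ((c⁻¹ • u) ⬝ᵥ ξ ω) := fun t ω => by
      rw [smul_dotProduct, smul_eq_mul]; field_simp
    refine ⟨fun t => by simp only [h2]; exact h1.integrable_exp_mul _, fun t => ?_⟩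
    have h3 := h1.mgf_le (t * c)
    simp only [mgf, h2] at h3 ⊢
    refine h3.trans (Real.exp_le_exp.mpr ?_)
    push_cast
    rw [mul_pow, sq c, hcc]
    nlinarith [sq_nonneg t]

/-- The exponent of the supermartingale controlling `∑ ⟨p, w_i⟩ ⟨q, x_i⟩`. -/
noncomputable def crossExponent (A : Matrix (Fin d) (Fin d) ℝ) (p q : Fin d → ℝ) (τ l : ℝ) (m : ℕ)
    (w : ℕ → Fin d → ℝ) : ℝ :=
  ∑ i ∈ Finset.range m, (l * ((p ⬝ᵥ w i) * (q ⬝ᵥ ltiState A w i)) -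
    l ^ 2 * τ / 2 * (q ⬝ᵥ ltiState A w i) ^ 2)

theorem measurable_dotProduct_left (p : Fin d → ℝ) : Measurable fun x : Fin d → ℝ => p ⬝ᵥ x := by
  unfold dotProduct
  fun_prop

theorem measurable_crossExponent (A : Matrix (Fin d) (Fin d) ℝ) (p q : Fin d → ℝ) (τ l : ℝ)
    (m : ℕ) : Measurable (crossExponent A p q τ l m) := by
  unfold crossExponent
  refine Finset.measurable_sum _ fun i _ => ?_
  have h1 : Measurable fun w : ℕ → Fin d → ℝ => p ⬝ᵥ w i :=
    (measurable_dotProduct_left p).comp (measurable_pi_apply i)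
  have h2 : Measurable fun w : ℕ → Fin d → ℝ => q ⬝ᵥ ltiState A w i :=
    (measurable_dotProduct_left q).comp (measurable_ltiState A i)
  fun_prop

/-- The state `x_m` depends only on `w_0, …, w_{m-1}`. Given these, the moment generating function
of `⟨p, w_m⟩` at `l ⟨q, x_m⟩` is cancelled by the compensator `l² τ ⟨q, x_m⟩² / 2`. -/
theorem lintegral_exp_crossExponent_le [IsProbabilityMeasure μ] (A : Matrix (Fin d) (Fin d) ℝ)
    (hind : iIndepFun η μ) (hη : ∀ i, Measurable (η i)) (p q : Fin d → ℝ) {τ : ℝ≥0}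
    (hsub : ∀ i, HasSubgaussianMGF (fun ω => p ⬝ᵥ η i ω) τ μ) (l : ℝ) (m : ℕ) :
    ∫⁻ ω, ENNReal.ofReal (Real.exp (crossExponent A p q τ l m fun i => η i ω)) ∂μ ≤ 1 := by
  induction m with
  | zero => simp [crossExponent]
  | succ m ih =>
    let G : (ℕ → Fin d → ℝ) → ℝ × ℝ :=
      fun w => (crossExponent A p q τ l m w, q ⬝ᵥ ltiState A w m)
    have hGmeas : Measurable G := (measurable_crossExponent A p q τ l m).prodMk
      ((measurable_dotProduct_left q).comp (measurable_ltiState A m))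
    have hpast : IndepFun (fun ω => G fun i => η i ω) (η m) μ := by
      refine hind.indepFun_past hη hGmeas fun w w' hw => ?_
      refine Prod.ext ?_ ?_
      · simp only [G, crossExponent]
        refine Finset.sum_congr rfl fun i hi => ?_
        have him := Finset.mem_range.mp hi
        rw [hw i him, ltiState_congr A fun j hj => hw j (by omega)]
      · simp only [G, ltiState_congr A hw]
    let g : ℝ × ℝ → (Fin d → ℝ) → ℝ≥0∞ := fun x y =>
      ENNReal.ofReal (Real.exp (l * ((p ⬝ᵥ y) * x.2) - l ^ 2 * τ / 2 * x.2 ^ 2))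
    have hg : Measurable (Function.uncurry g) := by
      have h1 : Measurable fun z : (ℝ × ℝ) × (Fin d → ℝ) => p ⬝ᵥ z.2 :=
        (measurable_dotProduct_left p).comp measurable_snd
      unfold g Function.uncurry
      fun_prop
    have hηω : Measurable fun ω i => η i ω := measurable_pi_lambda _ hη
    have hle := lintegral_mul_le_of_indepFun (hGmeas.comp hηω) (hη m) hpast
      (f := fun x => ENNReal.ofReal (Real.exp x.1)) (by fun_prop) hg (fun x => by
        have h1 := (hsub m).lintegral_exp_mul_le (l * x.2)
        simp only [g]
        have h2 : ∀ ω, ENNReal.ofReal (Real.exp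
            (l * ((p ⬝ᵥ η m ω) * x.2) - l ^ 2 * τ / 2 * x.2 ^ 2)) =
            ENNReal.ofReal (Real.exp (l * x.2 * (p ⬝ᵥ η m ω))) *
              ENNReal.ofReal (Real.exp (-(τ * (l * x.2) ^ 2 / 2))) := fun ω => by
          rw [← ENNReal.ofReal_mul (Real.exp_nonneg _), ← Real.exp_add]
          congr 2; ring
        simp only [h2]
        rw [lintegral_mul_const' _ _ ENNReal.ofReal_ne_top]
        calc _ ≤ ENNReal.ofReal (Real.exp (τ * (l * x.2) ^ 2 / 2)) *
              ENNReal.ofReal (Real.exp (-(τ * (l * x.2) ^ 2 / 2))) := by gcongr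
          _ = 1 := by
            rw [← ENNReal.ofReal_mul (Real.exp_nonneg _), ← Real.exp_add]; simp)
    refine le_trans (le_of_eq ?_) (hle.trans ih)
    refine lintegral_congr fun ω => ?_
    simp only [Function.comp, G, g]
    rw [← ENNReal.ofReal_mul (Real.exp_nonneg _), ← Real.exp_add, crossExponent,
      Finset.sum_range_succ]
    rfl

theorem measure_crossExponent_ge_le [IsProbabilityMeasure μ] (A : Matrix (Fin d) (Fin d) ℝ)
    (hind : iIndepFun η μ) (hη : ∀ i, Measurable (η i)) (p q : Fin d → ℝ) {τ : ℝ≥0}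
    (hsub : ∀ i, HasSubgaussianMGF (fun ω => p ⬝ᵥ η i ω) τ μ) (l : ℝ) (m : ℕ) (K : ℝ) :
    μ {ω | K ≤ crossExponent A p q τ l m fun i => η i ω} ≤ ENNReal.ofReal (Real.exp (-K)) :=
  measure_le_of_lintegral_exp_le_one
    ((measurable_crossExponent A p q τ l m).comp (measurable_pi_lambda _ hη))
    (lintegral_exp_crossExponent_le A hind hη p q hsub l m) K

/-- The state is subgaussian, with the Gramian as variance proxy. -/
theorem hasSubgaussianMGF_dotProduct_ltiState [IsProbabilityMeasure μ]
    {A : Matrix (Fin d) (Fin d) ℝ} (hA : IsSchurStable A)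
    (hind : iIndepFun η μ) (hη : ∀ i, Measurable (η i)) {σ : ℝ≥0}
    (h : ∀ i, ∀ u : Fin d → ℝ, u ⬝ᵥ u = 1 → HasSubgaussianMGF (fun ω => u ⬝ᵥ η i ω) (σ ^ 2) μ)
    (m : ℕ) (q : Fin d → ℝ) {τ : ℝ≥0} (hτ : (σ : ℝ) ^ 2 * quad (gramianInf A) q ≤ τ) :
    HasSubgaussianMGF (fun ω => q ⬝ᵥ ltiState A (fun i => η i ω) m) τ μ := by
  have hq0 : ∀ q, 0 ≤ quad (gramianInf A) q := fun q => by
    rw [← gramian_one]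
    refine le_trans ?_ (hA.quad_le_quad_gramian (fun u => ?_) q).2 <;>
    · rw [quad_one]; exact dotProduct_self_nonneg' _
  induction m generalizing q τ with
  | zero =>
    simp only [ltiState, dotProduct_zero]
    refine ⟨fun t => by simp, fun t => ?_⟩
    simp only [mgf, mul_zero, Real.exp_zero, integral_const, probReal_univ, smul_eq_mul, mul_one]
    exact Real.one_le_exp (by positivity)
  | succ m ih =>
    -- From `⟨q, x_{m+1}⟩ = ⟨Aᵀ q, x_m⟩ + ⟨q, η_m⟩` with independent summands the variance proxies
    -- add, and the Lyapunov equation says that they add up to `σ² Γ(q)`.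
    let τ₁ : ℝ≥0 := ⟨σ ^ 2 * quad (gramianInf A) (Aᵀ *ᵥ q), mul_nonneg (sq_nonneg _) (hq0 _)⟩
    let τ₂ : ℝ≥0 := ⟨σ ^ 2 * (q ⬝ᵥ q), mul_nonneg (sq_nonneg _) (dotProduct_self_nonneg' q)⟩
    have h1 := ih (Aᵀ *ᵥ q) (τ := τ₁) le_rfl
    have h2 := hasSubgaussianMGF_dotProduct (h m) (τ := τ₂) q le_rfl
    have hpast : IndepFun (fun ω => (Aᵀ *ᵥ q) ⬝ᵥ ltiState A (fun i => η i ω) m) (η m) μ :=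
      hind.indepFun_past hη (G := fun w => (Aᵀ *ᵥ q) ⬝ᵥ ltiState A w m)
        ((measurable_dotProduct_left _).comp (measurable_ltiState A m))
        fun w w' hw => by simp only [ltiState_congr A hw]
    have h3 := h1.add_of_indepFun h2 (hpast.comp measurable_id (measurable_dotProduct_left q))
    have hsum : (τ₁ + τ₂ : ℝ≥0) ≤ τ := by
      rw [← NNReal.coe_le_coe]
      refine le_trans (le_of_eq ?_) hτ
      have h4 := congrArg (quad · q) (hA.gramian_eq 1)
      simp only [quad_add, quad_mul_mul_transpose, gramian_one, quad_one] at h4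
      rw [NNReal.coe_add, h4, mul_add]
      rfl
    have h5 : ∀ ω, q ⬝ᵥ ltiState A (fun i => η i ω) (m + 1) =
        (Aᵀ *ᵥ q) ⬝ᵥ ltiState A (fun i => η i ω) m + q ⬝ᵥ η m ω := fun ω => by
      simp only [ltiState, dotProduct_add]
      rw [Matrix.dotProduct_mulVec, Matrix.mulVec_transpose]
    simp only [h5]
    refine ⟨h3.integrable_exp_mul, fun t => (h3.mgf_le t).trans (Real.exp_le_exp.mpr ?_)⟩
    have : ((τ₁ + τ₂ : ℝ≥0) : ℝ) ≤ τ := hsum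
    gcongr

end StateProcess

/-! ### Moment matrices of sequences of vectors -/

section Moment

variable {d : ℕ}

/-- The matrix `∑_{i < n} v_i w_iᵀ`. -/
def momentMatrix (v w : ℕ → Fin d → ℝ) (n : ℕ) : Matrix (Fin d) (Fin d) ℝ :=
  ∑ i ∈ Finset.range n, Matrix.vecMulVec (v i) (w i)

theorem dotProduct_momentMatrix (v w : ℕ → Fin d → ℝ) (n : ℕ) (p q : Fin d → ℝ) :
    p ⬝ᵥ momentMatrix v w n *ᵥ q = ∑ i ∈ Finset.range n, (p ⬝ᵥ v i) * (q ⬝ᵥ w i) := by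
  simp only [momentMatrix, Matrix.sum_mulVec, dotProduct_sum, Matrix.vecMulVec_mulVec]
  refine Finset.sum_congr rfl fun i _ => ?_
  rw [dotProduct_comm (w i)]
  simp [dotProduct_smul, mul_comm]

theorem quad_momentMatrix (v : ℕ → Fin d → ℝ) (n : ℕ) (u : Fin d → ℝ) :
    quad (momentMatrix v v n) u = ∑ i ∈ Finset.range n, (u ⬝ᵥ v i) ^ 2 := by
  simp only [quad, dotProduct_momentMatrix, sq]

theorem momentMatrix_isHermitian (v : ℕ → Fin d → ℝ) (n : ℕ) :
    (momentMatrix v v n).IsHermitian := by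
  unfold Matrix.IsHermitian momentMatrix
  rw [Matrix.conjTranspose_eq_transpose_of_trivial, Matrix.transpose_sum]
  exact Finset.sum_congr rfl fun i _ => Matrix.transpose_vecMulVec _ _

theorem quad_neg_right (M : Matrix (Fin d) (Fin d) ℝ) (u : Fin d → ℝ) :
    quad M (-u) = quad M u := by
  have := quad_smul_right M u (-1)
  simpa using this

theorem dotProduct_mulVec_eq (A : Matrix (Fin d) (Fin d) ℝ) (u x : Fin d → ℝ) :
    u ⬝ᵥ A *ᵥ x = (Aᵀ *ᵥ u) ⬝ᵥ x := by
  rw [Matrix.dotProduct_mulVec, Matrix.mulVec_transpose]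

/-- A two-sided bound on a quadratic form from a one-sided bound on a bilinear form on nets. -/
theorem IsFormNet.abs_quad_le {M : Matrix (Fin d) (Fin d) ℝ} {N : Finset (Fin d → ℝ)}
    (hN : IsFormNet M N) (hM : ∀ u, 0 ≤ quad M u) (B : Matrix (Fin d) (Fin d) ℝ) (κ : ℝ)
    (h : ∀ p ∈ N, ∀ q ∈ N, p ⬝ᵥ B *ᵥ q ≤ κ) (u : Fin d → ℝ) :
    |quad B u| ≤ 4 * κ * quad M u := by
  have h1 := hN.bilin_le hN B κ h u u
  have h2 := hN.bilin_le hN B κ h u (-u)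
  rw [quad_neg_right, Matrix.mulVec_neg, dotProduct_neg] at h2
  have h3 := Real.mul_self_sqrt (hM u)
  rw [mul_assoc, h3] at h1 h2
  rw [abs_le]
  exact ⟨by unfold quad at *; linarith, h1⟩

/-- The second moments of the states satisfy a perturbed Lyapunov equation. -/
theorem sum_sq_ltiState (A : Matrix (Fin d) (Fin d) ℝ) (w : ℕ → Fin d → ℝ) (n : ℕ)
    (u : Fin d → ℝ) :
    ∑ i ∈ Finset.range (n + 1), (u ⬝ᵥ ltiState A w i) ^ 2 =
      ∑ i ∈ Finset.range (n + 1), ((Aᵀ *ᵥ u) ⬝ᵥ ltiState A w i) ^ 2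
        - ((Aᵀ *ᵥ u) ⬝ᵥ ltiState A w n) ^ 2
        + 2 * (∑ i ∈ Finset.range n, (u ⬝ᵥ w i) * ((Aᵀ *ᵥ u) ⬝ᵥ ltiState A w i))
        + ∑ i ∈ Finset.range n, (u ⬝ᵥ w i) ^ 2 := by
  rw [Finset.sum_range_succ', Finset.sum_range_succ _ n]
  simp only [ltiState, dotProduct_add, dotProduct_zero, dotProduct_mulVec_eq]
  rw [add_sub_cancel_right, Finset.mul_sum, ← Finset.sum_add_distrib, ← Finset.sum_add_distrib]
  rw [zero_pow two_ne_zero, add_zero]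
  exact Finset.sum_congr rfl fun i _ => by ring

end Moment

/-! ### The empirical covariance of the states -/

section Covariance

variable {d : ℕ} {A S : Matrix (Fin d) (Fin d) ℝ} {w : ℕ → Fin d → ℝ} {n : ℕ} {b g K : ℝ}
  {N : Finset (Fin d → ℝ)}

/-- The empirical covariance of the noise. -/
theorem abs_quad_noise_le (hS : S.IsHermitian) (hS0 : ∀ u, 0 ≤ quad S u) (hN : IsFormNet S N)
    (ha : ∀ p ∈ N, ∀ q ∈ N, ∀ v, v = p + q ∨ v = p - q →
      |∑ i ∈ Finset.range n, ((v ⬝ᵥ w i) ^ 2 - quad S v)| ≤ n / 20) (u : Fin d → ℝ) :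
    |∑ i ∈ Finset.range n, (u ⬝ᵥ w i) ^ 2 - n * quad S u| ≤ n / 10 * quad S u := by
  set B := momentMatrix w w n - (n : ℝ) • S with hB
  have hBq : ∀ v, quad B v = ∑ i ∈ Finset.range n, (v ⬝ᵥ w i) ^ 2 - n * quad S v := fun v => by
    rw [hB, quad_sub, quad_smul, quad_momentMatrix]
  have hBh : B.IsHermitian := by
    refine (momentMatrix_isHermitian w n).sub ?_
    have hS' : Sᵀ = S := by simpa using hS.eq
    simp [Matrix.IsHermitian, Matrix.transpose_smul, hS']
  have hBv : ∀ v, quad B v = ∑ i ∈ Finset.range n, ((v ⬝ᵥ w i) ^ 2 - quad S v) := fun v => by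
    rw [hBq, Finset.sum_sub_distrib]; simp
  rw [← hBq]
  -- Polarisation: `4 ⟨p, B q⟩` is the difference of the forms at `p + q` and `p - q`, each at most
  -- `n/20` in absolute value. The net factor `4` turns `n/40` into `n/10`.
  have := hN.abs_quad_le hS0 B (n / 40) (fun p hp q hq => ?_) u
  · linarith
  · have h1 := ha p hp q hq _ (Or.inl rfl)
    have h2 := ha p hp q hq _ (Or.inr rfl)
    rw [← hBv] at h1 h2
    rw [quad_add_right B p hBh] at h1
    rw [quad_sub_right B p hBh] at h2
    have := abs_le.mp h1
    have := abs_le.mp h2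
    linarith

/-- The cross terms, bounded by the empirical covariance itself. -/
theorem abs_cross_le (hS0 : ∀ u, 0 ≤ quad S u)
    (hA : ∀ u, quad (A * gramian A S * Aᵀ) u ≤ quad (gramian A S) u)
    (hS1 : ∀ u, u ⬝ᵥ u ≤ quad S u)
    (hG : ∀ u, quad (gramian A S) u ≤ b * g * (u ⬝ᵥ u)) (hN : IsFormNet S N)
    (hb : 0 < b) (hg : 0 < g) (hK : 1600 * (b ^ 2 * g * K) ≤ n)
    (hcross : ∀ p ∈ N, ∀ q ∈ N,
      crossExponent A p (Aᵀ *ᵥ q) (b / 2) (1 / (20 * (b ^ 2 * g))) n w ≤ K)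
    {s : ℝ} (hs : 0 ≤ s) (hV : ∀ u, ∑ i ∈ Finset.range (n + 1), (u ⬝ᵥ ltiState A w i) ^ 2 ≤
      s * n * quad (gramian A S) u) (u : Fin d → ℝ) :
    |2 * ∑ i ∈ Finset.range n, (u ⬝ᵥ w i) * ((Aᵀ *ᵥ u) ⬝ᵥ ltiState A w i)| ≤
      (1 / 10 + s / 10) * n * quad S u := by
  set B := momentMatrix w (fun i => A *ᵥ ltiState A w i) n with hB
  have hBq : ∀ p q, p ⬝ᵥ B *ᵥ q =
      ∑ i ∈ Finset.range n, (p ⬝ᵥ w i) * ((Aᵀ *ᵥ q) ⬝ᵥ ltiState A w i) := fun p q => by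
    rw [hB, dotProduct_momentMatrix]
    simp only [dotProduct_mulVec_eq]
  have hbg : 0 < b ^ 2 * g := by positivity
  -- With this `l` the compensator contributes `s n / 80` and, by the burn-in condition, `K / l ≤ n
  -- / 80`. The net factor `4` and the factor `2` in the cross term give `1/10 + s/10`.
  set l : ℝ := 1 / (20 * (b ^ 2 * g)) with hl
  have hl0 : 0 < l := by positivity
  have := hN.abs_quad_le hS0 B ((1 / 80 + s / 80) * n) (fun p hp q hq => ?_) u
  · rw [quad, hBq] at this
    rw [abs_mul, abs_two]
    linarith
  · have h1 := hcross p hp q hq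
    rw [crossExponent, Finset.sum_sub_distrib, ← Finset.mul_sum, ← Finset.mul_sum, ← hBq] at h1
    have h2 : ∑ i ∈ Finset.range n, ((Aᵀ *ᵥ q) ⬝ᵥ ltiState A w i) ^ 2 ≤ s * n * (b * g) := by
      have h3 := hV (Aᵀ *ᵥ q)
      rw [Finset.sum_range_succ, ← quad_mul_mul_transpose] at h3
      have h4 : quad (A * gramian A S * Aᵀ) q ≤ b * g := by
        refine (hA q).trans ((hG q).trans ?_)
        have := (hS1 q).trans (hN.1 q hq)
        nlinarith [mul_pos hb hg]
      have h5 : s * n * quad (A * gramian A S * Aᵀ) q ≤ s * n * (b * g) := by gcongr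
      nlinarith [sq_nonneg ((Aᵀ *ᵥ q) ⬝ᵥ ltiState A w n)]
    have h6 : l ^ 2 * (b / 2) / 2 *
        ∑ i ∈ Finset.range n, ((Aᵀ *ᵥ q) ⬝ᵥ ltiState A w i) ^ 2 ≤
        l ^ 2 * (b / 2) / 2 * (s * n * (b * g)) := by gcongr
    have h7 : l ^ 2 * (b / 2) / 2 * (s * n * (b * g)) = l * (s / 80 * n) := by
      have : l * (b ^ 2 * g) = 1 / 20 := by rw [hl]; field_simp
      calc _ = l * (l * (b ^ 2 * g)) * (s * n) / 4 := by ring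
        _ = _ := by rw [this]; ring
    have h8 : K ≤ l * (n / 80) := by
      rw [hl, div_mul_eq_mul_div, le_div_iff₀ (by positivity)]
      linarith
    have h9 : l * (p ⬝ᵥ B *ᵥ q) ≤ l * ((1 / 80 + s / 80) * n) := by
      calc _ ≤ K + l * (s / 80 * n) := by linarith
        _ ≤ _ := by linarith
    exact le_of_mul_le_mul_left h9 hl0

/-- Two-sided control of the empirical covariance of the states on the good event. -/
theorem empirical_covariance_bounds (hstable : IsSchurStable A) (hS : S.IsHermitian)
    (hS1 : ∀ u, u ⬝ᵥ u ≤ quad S u)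
    (hG : ∀ u, quad (gramian A S) u ≤ b * g * (u ⬝ᵥ u)) (hN : IsFormNet S N)
    (hb : 1 ≤ b) (hg : 0 < g) (hn : 0 < n) (hK0 : 0 ≤ K) (hK : 1600 * (b ^ 2 * g * K) ≤ n)
    (ha : ∀ p ∈ N, ∀ q ∈ N, ∀ v, v = p + q ∨ v = p - q →
      |∑ i ∈ Finset.range n, ((v ⬝ᵥ w i) ^ 2 - quad S v)| ≤ n / 20)
    (hcross : ∀ p ∈ N, ∀ q ∈ N,
      crossExponent A p (Aᵀ *ᵥ q) (b / 2) (1 / (20 * (b ^ 2 * g))) n w ≤ K)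
    (hlast : ∀ q ∈ N, (Aᵀ *ᵥ q) ⬝ᵥ ltiState A w n ≤ √(b * g * K)) (u : Fin d → ℝ) :
    n / 2 * quad (gramian A S) u ≤ ∑ i ∈ Finset.range (n + 1), (u ⬝ᵥ ltiState A w i) ^ 2 ∧
      ∑ i ∈ Finset.range (n + 1), (u ⬝ᵥ ltiState A w i) ^ 2 ≤
        4 / 3 * n * quad (gramian A S) u := by
  have hn' : (0 : ℝ) < n := by exact_mod_cast hn
  have hS0 : ∀ u, 0 ≤ quad S u := fun u => (dotProduct_self_nonneg' u).trans (hS1 u)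
  have hGle := hstable.quad_le_quad_gramian hS0
  have hG0 : ∀ u, 0 ≤ quad (gramian A S) u := fun u => (hS0 u).trans (hGle u).2
  have hGeq : ∀ u, quad (gramian A S) u = quad (gramian A S) (Aᵀ *ᵥ u) + quad S u := fun u => by
    have := congrArg (quad · u) (hstable.gramian_eq S)
    simpa only [quad_add, quad_mul_mul_transpose] using this
  have hnoise := abs_quad_noise_le hS hS0 hN ha
  set P := momentMatrix (ltiState A w) (ltiState A w) (n + 1) with hP
  have hPq : ∀ u, quad P u = ∑ i ∈ Finset.range (n + 1), (u ⬝ᵥ ltiState A w i) ^ 2 :=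
    quad_momentMatrix _ _
  have hrec := sum_sq_ltiState A w n
  -- Noise contributes at most `11/10` and cross terms at most `1/10 + s/10`, relative to `n S`; the
  -- boundary term has a favourable sign. The map `s ↦ 6/5 + s/10` is a contraction with fixed point
  -- `4/3`.
  have hstep : ∀ s : ℝ, 0 ≤ s → (∀ u, quad P u ≤ s * n * quad (gramian A S) u) →
      ∀ u, quad P u ≤ (6 / 5 + s / 10) * n * quad (gramian A S) u := by
    intro s hs hV
    have hc := abs_cross_le hS0 (fun u => (hGle u).1) hS1 hG hN (by linarith) hg hK hcross hs
      (fun u => (hPq u).symm.le.trans (hV u))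
    have := hstable.quad_nonneg (D := ((6 / 5 + s / 10) * n) • gramian A S - P) fun u => ?_
    · intro u
      have h1 := this u
      rw [quad_sub, quad_smul] at h1
      linarith
    · rw [quad_mul_mul_transpose]
      simp only [quad_sub, quad_smul, hPq, hrec u, hGeq u]
      have h1 := (abs_le.mp (hc u)).2
      have h2 := (abs_le.mp (hnoise u)).2
      nlinarith [sq_nonneg ((Aᵀ *ᵥ u) ⬝ᵥ ltiState A w n)]
  have hupper : ∀ u, quad P u ≤ 4 / 3 * n * quad (gramian A S) u := by
    -- The iteration may start from any finite bound, however large: its influence decays like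
    -- `(1/10)^k`.
    let s₀ : ℝ := opNorm P / n
    have hop : 0 ≤ opNorm P := by
      let _ := Matrix.instL2OpNormedAddCommGroup (m := Fin d) (n := Fin d) (𝕜 := ℝ)
      exact norm_nonneg P
    have hs₀ : 0 ≤ s₀ := by positivity
    have hiter : ∀ k : ℕ, ∀ u, quad P u ≤
        (4 / 3 + (1 / 10) ^ k * s₀) * n * quad (gramian A S) u := by
      intro k
      induction k with
      | zero =>
        intro u
        have h1 := quad_le_opNorm P u
        have h2 : u ⬝ᵥ u ≤ quad (gramian A S) u := (hS1 u).trans (hGle u).2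
        have h3 : opNorm P = s₀ * n := by simp only [s₀]; field_simp
        rw [h3] at h1
        have h4 : s₀ * n * (u ⬝ᵥ u) ≤ s₀ * n * quad (gramian A S) u := by gcongr
        nlinarith [mul_nonneg hn'.le (hG0 u)]
      | succ k ih =>
        intro u
        refine (hstep _ (by positivity) ih u).trans (le_of_eq ?_)
        rw [pow_succ]
        ring
    intro u
    refine ge_of_tendsto' (x := Filter.atTop) (f := fun k : ℕ =>
      (4 / 3 + (1 / 10 : ℝ) ^ k * s₀) * n * quad (gramian A S) u) ?_ fun k => hiter k u
    have h1 := tendsto_pow_atTop_nhds_zero_of_lt_one (r := (1 / 10 : ℝ)) (by norm_num) (by norm_num)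
    have h2 := (((h1.mul_const s₀).const_add (4 / 3)).mul_const (n : ℝ)).mul_const
      (quad (gramian A S) u)
    simpa using h2
  have hc := abs_cross_le hS0 (fun u => (hGle u).1) hS1 hG hN (by linarith) hg hK hcross
    (by norm_num : (0 : ℝ) ≤ 4 / 3) (fun u => (hPq u).symm.le.trans (hupper u))
  have hlast' : ∀ u, ((Aᵀ *ᵥ u) ⬝ᵥ ltiState A w n) ^ 2 ≤ n / 10 * quad S u := by
    intro u
    have h1 : ∀ u, (Aᵀ *ᵥ u) ⬝ᵥ ltiState A w n ≤ 2 * √(b * g * K) * √(quad S u) := fun u => by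
      have := hN.2 (A *ᵥ ltiState A w n) (√(b * g * K)) (fun q hq => by
        rw [dotProduct_comm, dotProduct_mulVec_eq]; exact hlast q hq) u
      rwa [dotProduct_comm, dotProduct_mulVec_eq] at this
    have h2 := h1 (-u)
    rw [quad_neg_right, Matrix.mulVec_neg, neg_dotProduct] at h2
    have h3 : ((Aᵀ *ᵥ u) ⬝ᵥ ltiState A w n) ^ 2 ≤ (2 * √(b * g * K) * √(quad S u)) ^ 2 :=
      sq_le_sq.mpr ((abs_le.mpr ⟨by linarith, h1 u⟩).trans (le_abs_self _))
    rw [mul_pow, mul_pow, Real.sq_sqrt (by positivity), Real.sq_sqrt (hS0 u)] at h3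
    refine h3.trans (mul_le_mul_of_nonneg_right ?_ (hS0 u))
    have : b * g * K ≤ b ^ 2 * g * K := by
      have : b * (g * K) ≤ b * (b * (g * K)) :=
        mul_le_mul_of_nonneg_left (le_mul_of_one_le_left (by positivity) hb) (by linarith)
      nlinarith
    linarith
  -- Relative to `n S`, the budget is `9/10` from the noise, minus `1/10` for the boundary term,
  -- minus `1/10 + (4/3)/10` for the cross terms, leaving `17/30 ≥ 1/2`.
  have hlower := hstable.quad_nonneg (D := P - (n / 2 : ℝ) • gramian A S) fun u => by
    rw [quad_mul_mul_transpose]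
    simp only [quad_sub, quad_smul, hPq, hrec u, hGeq u]
    have h1 := (abs_le.mp (hc u)).1
    have h2 := (abs_le.mp (hnoise u)).1
    have h3 := hlast' u
    nlinarith [mul_nonneg hn'.le (hS0 u)]
  have h1 := hlower u
  rw [quad_sub, quad_smul, hPq] at h1
  rw [← hPq]
  exact ⟨by rw [hPq]; linarith, hupper u⟩

/-- The noise-state correlation on the good event. -/
theorem noise_state_correlation_le {G : Matrix (Fin d) (Fin d) ℝ} {N₁ N₂ : Finset (Fin d → ℝ)}
    (hN₁ : IsFormNet 1 N₁) (hN₂ : IsFormNet G N₂) {v : ℝ} (hv : 0 < v) (hn : 0 < n)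
    (hK : 0 < K)
    (hV : ∀ u, ∑ i ∈ Finset.range (n + 1), (u ⬝ᵥ ltiState A w i) ^ 2 ≤ 4 / 3 * n * quad G u)
    (hcross : ∀ p ∈ N₁, ∀ q ∈ N₂, crossExponent A p q v (√(K / (n * v))) (n + 1) w ≤ K)
    (p q : Fin d → ℝ) :
    ∑ i ∈ Finset.range (n + 1), (p ⬝ᵥ w i) * (q ⬝ᵥ ltiState A w i) ≤
      20 / 3 * √(n * v * K) * √(p ⬝ᵥ p) * √(quad G q) := by
  have hn' : (0 : ℝ) < n := by exact_mod_cast hn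
  set B := momentMatrix w (ltiState A w) (n + 1) with hB
  have hBq : ∀ p q, p ⬝ᵥ B *ᵥ q =
      ∑ i ∈ Finset.range (n + 1), (p ⬝ᵥ w i) * (q ⬝ᵥ ltiState A w i) :=
    fun p q => dotProduct_momentMatrix _ _ _ _ _
  -- This `l` makes `K / l = √(n v K)`; the compensator then adds `2/3` of the same quantity, for
  -- `5/3` in total, and the net factor `4` gives `20/3`.
  set l := √(K / (n * v)) with hl
  have hl0 : 0 < l := Real.sqrt_pos.mpr (by positivity)
  have hl2 : l ^ 2 * (n * v) = K := by
    rw [hl, Real.sq_sqrt (by positivity)]; field_simp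
  have hlK : l * √(n * v * K) = K := by
    rw [hl, ← Real.sqrt_mul (by positivity)]
    rw [show K / (n * v) * (n * v * K) = K * K by field_simp]
    exact Real.sqrt_mul_self hK.le
  have := hN₁.bilin_le hN₂ B (5 / 3 * √(n * v * K)) (fun p hp q hq => ?_) p q
  · rw [quad_one, hBq] at this
    linarith
  · have h1 := hcross p hp q hq
    rw [crossExponent, Finset.sum_sub_distrib, ← Finset.mul_sum, ← Finset.mul_sum, ← hBq] at h1
    have h2 : ∑ i ∈ Finset.range (n + 1), (q ⬝ᵥ ltiState A w i) ^ 2 ≤ 4 / 3 * n * 1 :=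
      (hV q).trans (by gcongr; exact hN₂.1 q hq)
    have h3 : l ^ 2 * v / 2 * ∑ i ∈ Finset.range (n + 1), (q ⬝ᵥ ltiState A w i) ^ 2 ≤
        l ^ 2 * v / 2 * (4 / 3 * n * 1) := by gcongr
    have h4 : l * (p ⬝ᵥ B *ᵥ q) ≤ l * (5 / 3 * √(n * v * K)) := by
      nlinarith
    exact le_of_mul_le_mul_left h4 hl0

end Covariance

/-! ### Deterministic error bound for least squares. -/

/-- The error of a least-squares estimate, from bounds on the empirical covariance of the states and
the noise-state correlation. -/
theorem IsLeastSquares.quad_error_le {d n : ℕ} {A G B : Matrix (Fin d) (Fin d) ℝ}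
    {w : ℕ → Fin d → ℝ} (hn : 0 < n) (h : IsLeastSquares (ltiX A w n) (ltiY A w n) B)
    (hG0 : ∀ u, 0 ≤ quad G u)
    (hlower : ∀ u, n / 2 * quad G u ≤ ∑ i ∈ Finset.range (n + 1), (u ⬝ᵥ ltiState A w i) ^ 2)
    {κ : ℝ} (hκ : 0 ≤ κ) (hcorr : ∀ p q, ∑ i ∈ Finset.range (n + 1), (p ⬝ᵥ w i) *
      (q ⬝ᵥ ltiState A w i) ≤ κ * √(p ⬝ᵥ p) * √(quad G q)) (p : Fin d → ℝ) (hp : p ⬝ᵥ p ≤ 1) :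
    quad G ((B - A)ᵀ *ᵥ p) ≤ 4 * κ ^ 2 / n ^ 2 := by
  have hn' : (0 : ℝ) < n := by exact_mod_cast hn
  set X := ltiX A w n with hX
  set z := (B - A)ᵀ *ᵥ p with hz
  let W : Matrix (Fin n) (Fin d) ℝ := Matrix.of fun i => w ((i : ℕ) + 1)
  have hY : ltiY A w n = X * Aᵀ + W := by
    ext i j
    simp only [ltiY, X, ltiX, W, Matrix.of_apply, Matrix.add_apply, Matrix.mul_apply,
      Matrix.transpose_apply, ltiState, Pi.add_apply, Matrix.mulVec, dotProduct, mul_comm]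
  have hnormal := h.normal_equations
  rw [hY, show X * Aᵀ + W - X * Bᵀ = W - X * (B - A)ᵀ by
    rw [Matrix.transpose_sub, Matrix.mul_sub]; abel] at hnormal
  have h1 : (X *ᵥ z) ⬝ᵥ (X *ᵥ z) = (X *ᵥ z) ⬝ᵥ (W *ᵥ p) := by
    have h2 := congrArg (fun M => z ⬝ᵥ M *ᵥ p) hnormal
    simp only [Matrix.mul_sub, Matrix.sub_mulVec, dotProduct_sub, ← Matrix.mulVec_mulVec,
      Matrix.zero_mulVec, dotProduct_zero] at h2
    rw [Matrix.dotProduct_mulVec z, Matrix.dotProduct_mulVec z, Matrix.vecMul_transpose, ← hz] at h2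
    linarith
  -- The rows of `X` are `x_1, …, x_n`; the sum over `range (n + 1)` also contains the index `0`,
  -- which contributes nothing because `x_0 = 0`.
  have hXv : ∀ v : Fin d → ℝ, ∀ f : ℕ → ℝ, (X *ᵥ v) ⬝ᵥ (fun i : Fin n => f (i + 1)) =
      ∑ i ∈ Finset.range (n + 1), f i * (v ⬝ᵥ ltiState A w i) := fun v f => by
    rw [Finset.sum_range_succ', Finset.sum_range]
    simp only [ltiState, dotProduct_zero, mul_zero, add_zero]
    refine Finset.sum_congr rfl fun i _ => ?_
    rw [mul_comm]
    congr 1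
    exact dotProduct_comm _ _
  have h2 : (X *ᵥ z) ⬝ᵥ (X *ᵥ z) = ∑ i ∈ Finset.range (n + 1), (z ⬝ᵥ ltiState A w i) ^ 2 := by
    have : X *ᵥ z = fun i : Fin n => z ⬝ᵥ ltiState A w (i + 1) :=
      funext fun i => dotProduct_comm _ _
    conv_lhs => rw [this]; lhs; rw [← this]
    rw [hXv z fun i => z ⬝ᵥ ltiState A w i]
    exact Finset.sum_congr rfl fun i _ => (sq _).symm
  have h3 : (X *ᵥ z) ⬝ᵥ (W *ᵥ p) =
      ∑ i ∈ Finset.range (n + 1), (p ⬝ᵥ w i) * (z ⬝ᵥ ltiState A w i) := by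
    have : W *ᵥ p = fun i : Fin n => p ⬝ᵥ w (i + 1) := funext fun i => dotProduct_comm _ _
    rw [this, hXv z fun i => p ⬝ᵥ w i]
  have h4 := hlower z
  have h5 := hcorr p z
  rw [← h3, ← h1, h2] at h5
  set y := √(quad G z) with hy
  have hyy : y ^ 2 = quad G z := Real.sq_sqrt (hG0 z)
  have hy0 : 0 ≤ y := Real.sqrt_nonneg _
  have hp1 : √(p ⬝ᵥ p) ≤ 1 := Real.sqrt_le_one.mpr hp
  have h6 : κ * √(p ⬝ᵥ p) * y ≤ κ * 1 * y := by gcongr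
  have h7 : n * y ≤ 2 * κ := by
    rcases hy0.eq_or_lt with h0 | h0
    · rw [← h0]; linarith
    · have : (n * y) * y ≤ (2 * κ) * y := by nlinarith
      exact le_of_mul_le_mul_right this h0
  rw [← hyy, le_div_iff₀ (by positivity)]
  nlinarith [mul_nonneg hn'.le hy0]

/-! ### Second moments of the noise. -/

section Covariance

variable {Ω : Type*} [MeasurableSpace Ω] {μ : Measure Ω} {d : ℕ}

/-- The second moment matrix of a random vector. -/
noncomputable def secondMoment (ξ : Ω → Fin d → ℝ) (μ : Measure Ω) : Matrix (Fin d) (Fin d) ℝ :=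
  Matrix.of fun a b => ∫ ω, ξ ω a * ξ ω b ∂μ

theorem secondMoment_isHermitian (ξ : Ω → Fin d → ℝ) : (secondMoment ξ μ).IsHermitian := by
  ext a b
  simp [secondMoment, mul_comm]

theorem quad_secondMoment {ξ : Ω → Fin d → ℝ} (h : ∀ a, MemLp (fun ω => ξ ω a) 2 μ)
    (u : Fin d → ℝ) : quad (secondMoment ξ μ) u = ∫ ω, (u ⬝ᵥ ξ ω) ^ 2 ∂μ := by
  have hint : ∀ a b, Integrable (fun ω => u a * (u b * (ξ ω a * ξ ω b))) μ := fun a b =>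
    (((h a).integrable_mul (h b)).const_mul _).const_mul _
  have h1 : ∀ ω, (u ⬝ᵥ ξ ω) ^ 2 = ∑ a, ∑ b, u a * (u b * (ξ ω a * ξ ω b)) := fun ω => by
    rw [sq, dotProduct, Finset.sum_mul_sum]
    exact Finset.sum_congr rfl fun a _ => Finset.sum_congr rfl fun b _ => by ring
  simp only [h1]
  rw [integral_finsetSum _ fun a _ => integrable_finsetSum _ fun b _ => hint a b]
  simp only [quad, dotProduct, Matrix.mulVec, Finset.mul_sum]
  refine Finset.sum_congr rfl fun a _ => ?_
  rw [integral_finsetSum _ fun b _ => hint a b]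
  refine Finset.sum_congr rfl fun b _ => ?_
  rw [integral_const_mul, integral_const_mul]
  simp only [secondMoment, Matrix.of_apply]
  ring

end Covariance

/-! ### Union bound and the good event. -/

/-- The level `K = 6 L` absorbs the union bound: `7 · 25^d ≤ 175^d ≤ e^{6d}`, and `δ^6 ≤ δ`. -/
theorem card_mul_exp_le {d : ℕ} (hd : 0 < d) {δ : ℝ} (h0 : 0 < δ) (h1 : δ < 1) :
    7 * 25 ^ d * Real.exp (-(6 * (d + Real.log (1 / δ)))) ≤ δ := by
  have e1 : Real.exp (-(6 * (d + Real.log (1 / δ)))) = δ ^ 6 * (Real.exp 6 ^ d)⁻¹ := by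
    rw [one_div, Real.log_inv, ← Real.exp_nat_mul, ← Real.exp_neg,
      show -(6 * ((d : ℝ) + -Real.log δ)) = (6 : ℕ) * Real.log δ + -(d * 6) by push_cast; ring,
      Real.exp_add, Real.exp_nat_mul, Real.exp_log h0]
  have e2 : (175 : ℝ) ≤ Real.exp 6 := by
    have h : Real.exp 6 = Real.exp 1 ^ 6 := by rw [← Real.exp_nat_mul]; norm_num
    rw [h]
    calc (175 : ℝ) ≤ 2.7 ^ 6 := by norm_num
      _ ≤ _ := by gcongr; linarith [Real.exp_one_gt_d9]
  have e3 : (7 : ℝ) * 25 ^ d ≤ Real.exp 6 ^ d := by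
    calc (7 : ℝ) * 25 ^ d ≤ 7 ^ d * 25 ^ d := by
          gcongr; exact le_self_pow₀ (by norm_num) hd.ne'
      _ = 175 ^ d := by rw [← mul_pow]; norm_num
      _ ≤ _ := by gcongr
  rw [e1, ← mul_assoc, ← div_eq_mul_inv, div_le_iff₀ (by positivity)]
  have e4 : δ ^ 6 ≤ δ := by
    simpa using pow_le_pow_of_le_one h0.le h1.le (show 1 ≤ 6 by norm_num)
  calc 7 * 25 ^ d * δ ^ 6 ≤ Real.exp 6 ^ d * δ := by gcongr
    _ = _ := mul_comm _ _

theorem measure_biUnion_le_card_mul {Ω ι : Type*} [MeasurableSpace Ω] (μ : Measure Ω)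
    (N : Finset ι) (E : ι → Set Ω) {k : ℕ} (hk : N.card ≤ k) {e : ℝ≥0∞}
    (h : ∀ p ∈ N, μ (E p) ≤ e) : μ (⋃ p ∈ N, E p) ≤ k * e := by
  refine (measure_biUnion_finset_le N E).trans ((Finset.sum_le_sum h).trans ?_)
  rw [Finset.sum_const, nsmul_eq_mul]
  gcongr

section GoodEvent

variable {Ω : Type*} [MeasurableSpace Ω] {μ : Measure Ω} [IsProbabilityMeasure μ] {d : ℕ}
  {A S : Matrix (Fin d) (Fin d) ℝ} {η : ℕ → Ω → Fin d → ℝ} {σ : ℝ≥0} {n : ℕ} {K : ℝ}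

/-- Chernoff bounds for both signs of `t`. The restriction `‖v‖² ≤ 4` suits sums and differences of
two net points and gives the variance proxy `4 σ²`. -/
theorem measure_abs_sum_sq_sub_gt_le (hind : iIndepFun η μ) (hη : ∀ i, Measurable (η i))
    (hsub : ∀ i, ∀ u : Fin d → ℝ, u ⬝ᵥ u = 1 → HasSubgaussianMGF (fun ω => u ⬝ᵥ η i ω) (σ ^ 2) μ)
    (hS : ∀ i u, ∫ ω, (u ⬝ᵥ η i ω) ^ 2 ∂μ = quad S u) (hσ : 1 ≤ 2 * (σ : ℝ) ^ 2)
    (hK : 9830400 * ((σ : ℝ) ^ 4 * K) ≤ n) {v : Fin d → ℝ} (hv : v ⬝ᵥ v ≤ 4) :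
    μ {ω | ¬ |∑ i ∈ Finset.range n, ((v ⬝ᵥ η i ω) ^ 2 - quad S v)| ≤ n / 20} ≤
      2 * ENNReal.ofReal (Real.exp (-K)) := by
  have hσ0 : 0 < (σ : ℝ) := by
    by_contra! h
    have : (σ : ℝ) = 0 := le_antisymm h σ.2
    rw [this] at hσ; norm_num at hσ
  -- Chosen so that the quadratic penalty `384 (4σ²)² t² n` equals `t n / 40`; the assumption
  -- `9830400 = 40 · 245760` bounds `K` by the other `t n / 40`.
  set t : ℝ := 1 / (245760 * (σ : ℝ) ^ 4) with ht
  have ht0 : 0 < t := by positivity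
  have htσ : t * (σ : ℝ) ^ 4 = 1 / 245760 := by rw [ht]; field_simp
  have hτ : ((4 * σ ^ 2 : ℝ≥0) : ℝ) = 4 * (σ : ℝ) ^ 2 := by push_cast; rfl
  have hbound : t * (4 * (σ : ℝ) ^ 2) ≤ 1 / 8 := by
    nlinarith [mul_pos ht0 (pow_pos hσ0 2)]
  have hsubv : ∀ i, HasSubgaussianMGF (fun ω => v ⬝ᵥ η i ω) (4 * σ ^ 2) μ := fun i =>
    hasSubgaussianMGF_dotProduct (hsub i) v (by rw [hτ]; nlinarith [sq_nonneg (σ : ℝ)])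
  have hindv : iIndepFun (fun i ω => v ⬝ᵥ η i ω) μ :=
    hind.comp (fun _ x => v ⬝ᵥ x) fun _ => measurable_dotProduct_left v
  have hmeas : ∀ i, Measurable fun ω => v ⬝ᵥ η i ω := fun i =>
    (measurable_dotProduct_left v).comp (hη i)
  have hpos : 0 < 4 * σ ^ 2 := by
    have : 0 < σ := hσ0
    positivity
  have h1 := measure_sum_sq_sub_ge_le hindv hsubv hmeas hpos (fun i => hS i v) (t := t)
    (by rw [abs_of_pos ht0, hτ]; exact hbound) n K
  have h2 := measure_sum_sq_sub_ge_le hindv hsubv hmeas hpos (fun i => hS i v) (t := -t)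
    (by rw [abs_neg, abs_of_pos ht0, hτ]; exact hbound) n K
  rw [two_mul]
  refine le_trans (measure_mono ?_) ((measure_union_le _ _).trans (add_le_add h1 h2))
  intro ω hω
  by_contra hcon
  simp only [Set.mem_union, Set.mem_ofPred_eq, not_or, not_le, hτ] at hcon
  refine hω (abs_le.mpr ?_)
  set s := ∑ i ∈ Finset.range n, ((v ⬝ᵥ η i ω) ^ 2 - quad S v)
  have h3 : n * (384 * (4 * (σ : ℝ) ^ 2) ^ 2 * t ^ 2) = t * (n / 40) := by
    calc _ = 6144 * (t * (σ : ℝ) ^ 4) * (t * n) := by ring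
      _ = _ := by rw [htσ]; ring
  have h4 : K ≤ t * (n / 40) := by
    rw [ht, div_mul_eq_mul_div, le_div_iff₀ (by positivity)]
    linarith
  obtain ⟨h5, h6⟩ := hcon
  rw [neg_sq] at h6
  rw [h3] at h5 h6
  constructor
  · have : t * (-s) ≤ t * (n / 20) := by linarith
    have := le_of_mul_le_mul_left this ht0
    linarith
  · have : t * s ≤ t * (n / 20) := by linarith
    exact le_of_mul_le_mul_left this ht0

/-- The subgaussian tail with proxy `σ² g`, at the level where its exponent is exactly `-K`. It
serves the boundary term of the Lyapunov recursion. -/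
theorem measure_last_state_gt_le (hA : IsSchurStable A) (hind : iIndepFun η μ)
    (hη : ∀ i, Measurable (η i))
    (hsub : ∀ i, ∀ u : Fin d → ℝ, u ⬝ᵥ u = 1 → HasSubgaussianMGF (fun ω => u ⬝ᵥ η i ω) (σ ^ 2) μ)
    (hσ : 0 < σ) (hK : 0 ≤ K) {g : ℝ} (hg : 0 < g) {q : Fin d → ℝ}
    (hq : quad (gramianInf A) q ≤ g) :
    μ {ω | ¬ q ⬝ᵥ ltiState A (fun i => η i ω) n ≤ √(2 * (σ : ℝ) ^ 2 * g * K)} ≤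
      ENNReal.ofReal (Real.exp (-K)) := by
  have hσ' : 0 < (σ : ℝ) := hσ
  let τ : ℝ≥0 := ⟨σ ^ 2 * g, by positivity⟩
  have h := hasSubgaussianMGF_dotProduct_ltiState hA hind hη hsub n q (τ := τ)
    (mul_le_mul_of_nonneg_left hq (sq_nonneg (σ : ℝ)))
  have h1 := h.measure_ge_le (Real.sqrt_nonneg (2 * (σ : ℝ) ^ 2 * g * K))
  rw [Real.sq_sqrt (by positivity)] at h1
  have h2 : -(2 * (σ : ℝ) ^ 2 * g * K) / (2 * τ) = -K := by
    change -(2 * (σ : ℝ) ^ 2 * g * K) / (2 * ((σ : ℝ) ^ 2 * g)) = -K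
    field_simp
  rw [h2] at h1
  refine le_trans (measure_mono fun ω hω => ?_)
    ((ENNReal.le_ofReal_iff_toReal_le (measure_ne_top μ _) (Real.exp_nonneg _)).mpr h1)
  exact (not_le.mp hω).le

/-- All the deviation bounds used for the estimator hold simultaneously with high probability. -/
theorem measure_not_good_event_le (hA : IsSchurStable A) (hind : iIndepFun η μ)
    (hη : ∀ i, Measurable (η i))
    (hsub : ∀ i, ∀ u : Fin d → ℝ, u ⬝ᵥ u = 1 → HasSubgaussianMGF (fun ω => u ⬝ᵥ η i ω) (σ ^ 2) μ)
    (hS : ∀ i u, ∫ ω, (u ⬝ᵥ η i ω) ^ 2 ∂μ = quad S u)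
    (hS1 : ∀ u, u ⬝ᵥ u ≤ quad S u) (hσ : 1 ≤ 2 * (σ : ℝ) ^ 2) (hK0 : 0 ≤ K)
    (hK : 9830400 * ((σ : ℝ) ^ 4 * K) ≤ n) {g : ℝ} (hg : 0 < g)
    (hΓ : ∀ u, quad (gramianInf A) u ≤ g * (u ⬝ᵥ u))
    {N N₁ N₂ : Finset (Fin d → ℝ)} (hN : IsFormNet S N)
    (hN₁ : IsFormNet 1 N₁) (hc : N.card ≤ 5 ^ d) (hc₁ : N₁.card ≤ 5 ^ d)
    (hc₂ : N₂.card ≤ 5 ^ d) (l l' : ℝ) :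
    μ {ω | ¬ ((∀ p ∈ N, ∀ q ∈ N, ∀ v, v = p + q ∨ v = p - q →
          |∑ i ∈ Finset.range n, ((v ⬝ᵥ η i ω) ^ 2 - quad S v)| ≤ n / 20) ∧
        (∀ p ∈ N, ∀ q ∈ N,
          crossExponent A p (Aᵀ *ᵥ q) ((σ : ℝ) ^ 2) l n (fun i => η i ω) ≤ K) ∧
        (∀ q ∈ N, (Aᵀ *ᵥ q) ⬝ᵥ ltiState A (fun i => η i ω) n ≤ √(2 * (σ : ℝ) ^ 2 * g * K)) ∧
        (∀ p ∈ N₁, ∀ q ∈ N₂,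
          crossExponent A p q ((σ : ℝ) ^ 2) l' (n + 1) (fun i => η i ω) ≤ K))} ≤
      ENNReal.ofReal (7 * 25 ^ d * Real.exp (-K)) := by
  set e := ENNReal.ofReal (Real.exp (-K)) with he
  have hσ0 : 0 < σ := by
    rw [pos_iff_ne_zero]
    rintro rfl
    norm_num at hσ
  let E₁ : (Fin d → ℝ) → Set Ω := fun v =>
    {ω | ¬ |∑ i ∈ Finset.range n, ((v ⬝ᵥ η i ω) ^ 2 - quad S v)| ≤ n / 20}
  let E₂ : (Fin d → ℝ) → (Fin d → ℝ) → ℝ → ℕ → Set Ω := fun p q l m =>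
    {ω | ¬ crossExponent A p q ((σ : ℝ) ^ 2) l m (fun i => η i ω) ≤ K}
  let E₃ : (Fin d → ℝ) → Set Ω := fun q =>
    {ω | ¬ (Aᵀ *ᵥ q) ⬝ᵥ ltiState A (fun i => η i ω) n ≤ √(2 * (σ : ℝ) ^ 2 * g * K)}
  have hp : ∀ p ∈ N, p ⬝ᵥ p ≤ 1 := fun p h => (hS1 p).trans (hN.1 p h)
  have h₁ : ∀ p ∈ N, ∀ q ∈ N, μ (E₁ (p + q)) ≤ 2 * e ∧ μ (E₁ (p - q)) ≤ 2 * e := by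
    intro p hpN q hqN
    have h1 := hp p hpN
    have h2 := hp q hqN
    have h3 := dotProduct_self_nonneg' (p + q)
    have h4 := dotProduct_self_nonneg' (p - q)
    have h5 : (p + q) ⬝ᵥ (p + q) + (p - q) ⬝ᵥ (p - q) = 2 * (p ⬝ᵥ p) + 2 * (q ⬝ᵥ q) := by
      simp only [add_dotProduct, dotProduct_add, sub_dotProduct, dotProduct_sub]; ring
    exact ⟨measure_abs_sum_sq_sub_gt_le hind hη hsub hS hσ hK (by linarith),
      measure_abs_sum_sq_sub_gt_le hind hη hsub hS hσ hK (by linarith)⟩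
  have h₂ : ∀ p, p ⬝ᵥ p ≤ 1 → ∀ q l m, μ (E₂ p q l m) ≤ e := by
    intro p hp1 q l m
    have h := measure_crossExponent_ge_le A hind hη p q (τ := σ ^ 2) (fun i =>
      hasSubgaussianMGF_dotProduct (hsub i) p (by
        push_cast; nlinarith [sq_nonneg (σ : ℝ)])) l m K
    refine (measure_mono fun ω hω => ?_).trans h
    have := (not_le.mp hω).le
    simpa using this
  have h₃ : ∀ q ∈ N, μ (E₃ q) ≤ e := by
    intro q hq
    refine measure_last_state_gt_le hA hind hη hsub hσ0 hK0 hg ?_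
    have h1 : ∀ u : Fin d → ℝ, 0 ≤ quad (1 : Matrix (Fin d) (Fin d) ℝ) u := fun u => by
      rw [quad_one]; exact dotProduct_self_nonneg' u
    have h2 := (hA.quad_le_quad_gramian h1 q).1
    rw [quad_mul_mul_transpose, gramian_one] at h2
    exact h2.trans ((hΓ q).trans (mul_le_of_le_one_right hg.le (hp q hq)))
  have hsub : {ω | ¬ ((∀ p ∈ N, ∀ q ∈ N, ∀ v, v = p + q ∨ v = p - q →
          |∑ i ∈ Finset.range n, ((v ⬝ᵥ η i ω) ^ 2 - quad S v)| ≤ n / 20) ∧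
        (∀ p ∈ N, ∀ q ∈ N,
          crossExponent A p (Aᵀ *ᵥ q) ((σ : ℝ) ^ 2) l n (fun i => η i ω) ≤ K) ∧
        (∀ q ∈ N, (Aᵀ *ᵥ q) ⬝ᵥ ltiState A (fun i => η i ω) n ≤ √(2 * (σ : ℝ) ^ 2 * g * K)) ∧
        (∀ p ∈ N₁, ∀ q ∈ N₂,
          crossExponent A p q ((σ : ℝ) ^ 2) l' (n + 1) (fun i => η i ω) ≤ K))} ⊆
      (⋃ p ∈ N, ⋃ q ∈ N, ((E₁ (p + q) ∪ E₁ (p - q)) ∪ E₂ p (Aᵀ *ᵥ q) l n)) ∪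
        ((⋃ q ∈ N, E₃ q) ∪ ⋃ p ∈ N₁, ⋃ q ∈ N₂, E₂ p q l' (n + 1)) := by
    intro ω hω
    by_contra hcon
    simp only [Set.mem_union, Set.mem_iUnion, not_or, not_exists, E₁, E₂, E₃, Set.mem_ofPred_eq,
      not_not] at hcon
    obtain ⟨c1, c2, c3⟩ := hcon
    refine hω ⟨?_, fun p hp q hq => (c1 p hp q hq).2, c2, c3⟩
    rintro p hp q hq v (rfl | rfl)
    · exact (c1 p hp q hq).1.1
    · exact (c1 p hp q hq).1.2
  -- Per pair of net points there are two two-sided events for `p ± q` and one cross event, `2 + 2 +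
  -- 1 = 5`. The other two unions are each counted once per pair, which yields the `7`.
  have hu₁ : μ (⋃ p ∈ N, ⋃ q ∈ N, ((E₁ (p + q) ∪ E₁ (p - q)) ∪ E₂ p (Aᵀ *ᵥ q) l n)) ≤
      ((5 ^ d : ℕ) : ℝ≥0∞) * (((5 ^ d : ℕ) : ℝ≥0∞) * (5 * e)) := by
    refine measure_biUnion_le_card_mul μ N _ hc fun p hpN =>
      measure_biUnion_le_card_mul μ N _ hc fun q hqN => ?_
    obtain ⟨h1, h2⟩ := h₁ p hpN q hqN
    refine ((measure_union_le _ _).trans (add_le_add ((measure_union_le _ _).trans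
      (add_le_add h1 h2)) (h₂ p (hp p hpN) _ _ _))).trans (le_of_eq ?_)
    ring
  have hu₂ : μ (⋃ q ∈ N, E₃ q) ≤ ((5 ^ d : ℕ) : ℝ≥0∞) * (((5 ^ d : ℕ) : ℝ≥0∞) * e) := by
    refine (measure_biUnion_le_card_mul μ N _ hc h₃).trans ?_
    gcongr
    exact le_mul_of_one_le_left' (by exact_mod_cast Nat.one_le_pow _ _ (by norm_num))
  have hu₃ : μ (⋃ p ∈ N₁, ⋃ q ∈ N₂, E₂ p q l' (n + 1)) ≤
      ((5 ^ d : ℕ) : ℝ≥0∞) * (((5 ^ d : ℕ) : ℝ≥0∞) * e) :=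
    measure_biUnion_le_card_mul μ N₁ _ hc₁ fun p hpN =>
      measure_biUnion_le_card_mul μ N₂ _ hc₂ fun q hqN =>
        h₂ p ((quad_one p).symm.le.trans (hN₁.1 p hpN)) _ _ _
  refine (measure_mono hsub).trans ((measure_union_le _ _).trans ((add_le_add hu₁
    ((measure_union_le _ _).trans (add_le_add hu₂ hu₃))).trans (le_of_eq ?_)))
  have h25 : (25 : ℝ≥0∞) ^ d = 5 ^ d * 5 ^ d := by rw [← mul_pow]; norm_num
  rw [ENNReal.ofReal_mul (by positivity), ENNReal.ofReal_mul (by norm_num),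
    ENNReal.ofReal_pow (by norm_num), ← he]
  push_cast
  simp only [ENNReal.ofReal_ofNat]
  rw [h25]
  ring

end GoodEvent

/-! ### Assembly of the theorem. -/

theorem mainTheorem8 :
    ∃ c C : ℝ, 0 < c ∧ 0 < C ∧
      ∀ {Ω : Type*} [MeasurableSpace Ω] (μ : Measure Ω) [IsProbabilityMeasure μ]
        (d r n : ℕ) (A : Matrix (Fin d) (Fin d) ℝ) (σ : ℝ≥0) (δ : ℝ)
        (η : ℕ → Ω → Fin d → ℝ) (Ahat : Ω → Matrix (Fin d) (Fin d) ℝ),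
        -- the system: a stable matrix of rank at most `r`
        IsSchurStable A →
        1 ≤ r → r ≤ d → A.rank ≤ r →
        0 < δ → δ < 1 →
        -- the noise: i.i.d., centred, `σ²`-subgaussian in every direction, covariance `⪰ I`
        (∀ i, Measurable (η i)) →
        iIndepFun η μ →
        (∀ i, IdentDistrib (η i) (η 0) μ μ) →
        (∀ a, ∫ ω, η 0 ω a ∂μ = 0) →
        (∀ u : Fin d → ℝ, u ⬝ᵥ u = 1 →
          HasSubgaussianMGF (fun ω => u ⬝ᵥ η 0 ω) (σ ^ 2) μ) →
        (∀ u : Fin d → ℝ, u ⬝ᵥ u ≤ ∫ ω, (u ⬝ᵥ η 0 ω) ^ 2 ∂μ) →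
        -- the estimator
        (∀ ω, IsRLSE r (ltiX A (fun i => η i ω) n) (ltiY A (fun i => η i ω) n) (Ahat ω)) →
        -- the burn-in condition on the number of samples
        c * (σ : ℝ) ^ 4 * opNorm (gramianInf A) ^ 3 / minEig (gramianInf_isHermitian A)
            * ((d : ℝ) + Real.log (1 / δ)) ≤ (n : ℝ) →
        -- the error bound fails with (outer) probability at most `δ`
        μ {ω | ¬ frobNorm (Ahat ω - A) ^ 2 ≤
            C * ((r : ℝ) * (σ : ℝ) ^ 2 * ((d : ℝ) + Real.log (1 / δ)) /
              ((n : ℝ) * harmonicEig r (gramianInf_isHermitian A)))} ≤ ENNReal.ofReal δ := by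
  -- With `K = 6 L`, `58982400 = 6 · 9830400` and `25600/3 = 8 · 4 · (20/3)² · 6`: truncation, least
  -- squares, squared correlation constant, and `K / L`.
  refine ⟨58982400, 25600 / 3, by norm_num, by norm_num, ?_⟩
  intro Ω _ μ _ d r n A σ δ η Ahat hA h1r hr hrank hδ0 hδ1 hη hind hid _ hsub0 hcov hest hburn
  have hd : 0 < d := by omega
  set L : ℝ := (d : ℝ) + Real.log (1 / δ)
  set g : ℝ := opNorm (gramianInf A)
  have hL0 : 0 < L := by
    have h1 : 0 < (d : ℝ) := by exact_mod_cast hd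
    have h2 : 0 ≤ Real.log (1 / δ) := Real.log_nonneg (by rw [le_div_iff₀ hδ0]; linarith)
    linarith
  have hsub : ∀ i, ∀ u : Fin d → ℝ, u ⬝ᵥ u = 1 →
      HasSubgaussianMGF (fun ω => u ⬝ᵥ η i ω) (σ ^ 2) μ := fun i u hu =>
    (hsub0 u hu).congr_identDistrib ((hid i).symm.comp (measurable_dotProduct_left u))
  have hmem : ∀ a, MemLp (fun ω => η 0 ω a) 2 μ := fun a => by
    have := (hsub0 (Pi.single a 1) (by simp)).memLp 2
    simpa using this
  set S := secondMoment (η 0) μ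
  have hSh : S.IsHermitian := secondMoment_isHermitian _
  have hS : ∀ i u, ∫ ω, (u ⬝ᵥ η i ω) ^ 2 ∂μ = quad S u := fun i u => by
    rw [quad_secondMoment hmem]
    exact ((hid i).comp ((measurable_dotProduct_left u).pow_const 2)).integral_eq
  have hS1 : ∀ u, u ⬝ᵥ u ≤ quad S u := fun u => (hcov u).trans (hS 0 u).le
  have he : (Pi.single ⟨0, hd⟩ 1 : Fin d → ℝ) ⬝ᵥ Pi.single ⟨0, hd⟩ 1 = 1 := by simp
  -- For `σ = 0` the noise would vanish almost surely in each direction, contradicting covariance `⪰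
  -- I`.
  have hσ0 : 0 < σ := by
    rw [pos_iff_ne_zero]
    rintro rfl
    have h1 := hsub0 _ he
    rw [zero_pow two_ne_zero] at h1
    have h2 := h1.ae_eq_zero_of_hasSubgaussianMGF_zero
    have h3 := hcov (Pi.single ⟨0, hd⟩ 1)
    rw [he, integral_eq_zero_of_ae (h2.mono fun ω hω => by
      simp only [Pi.zero_apply] at hω ⊢; rw [hω]; norm_num)] at h3
    linarith
  have hσ' : 0 < (σ : ℝ) := hσ0
  have hSb : ∀ u, quad S u ≤ 2 * (σ : ℝ) ^ 2 * (u ⬝ᵥ u) := fun u => by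
    rcases (dotProduct_self_nonneg' u).eq_or_lt with h0 | h0
    · rw [← h0, dotProduct_self_eq_zero.mp h0.symm]; simp [quad]
    · let τ : ℝ≥0 := ⟨σ ^ 2 * (u ⬝ᵥ u), by positivity⟩
      have hτ : 0 < τ := NNReal.coe_pos.mp (mul_pos (pow_pos hσ' 2) h0)
      have := (hasSubgaussianMGF_dotProduct hsub0 u (τ := τ) le_rfl).integral_sq_le
        ((measurable_dotProduct_left u).comp (hη 0)) hτ
      rw [hS 0 u] at this
      exact this.trans (le_of_eq (mul_assoc _ _ _).symm)
  have hb : 1 ≤ 2 * (σ : ℝ) ^ 2 := by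
    have := (hS1 (Pi.single ⟨0, hd⟩ 1)).trans (hSb _)
    rwa [he, mul_one] at this
  have hone : ∀ u : Fin d → ℝ, quad (1 : Matrix (Fin d) (Fin d) ℝ) u = u ⬝ᵥ u := quad_one
  have hΓ1 : ∀ u, u ⬝ᵥ u ≤ quad (gramianInf A) u := fun u => by
    rw [← gramian_one, ← hone u]
    exact (hA.quad_le_quad_gramian (fun u => (dotProduct_self_nonneg' u).trans (hone u).ge) u).2
  have hΓg : ∀ u, quad (gramianInf A) u ≤ g * (u ⬝ᵥ u) := quad_le_opNorm _
  obtain ⟨hmin1, hming⟩ := minEig_bounds hd (gramianInf_isHermitian A) hΓ1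
  have hg1 : 1 ≤ g := hmin1.trans hming
  have hΓG : ∀ u, quad (gramianInf A) u ≤ quad (gramian A S) u := fun u => by
    rw [← gramian_one]
    exact hA.gramian_mono (fun u => (hone u).le.trans (hS1 u)) u
  have hGg : ∀ u, quad (gramian A S) u ≤ 2 * (σ : ℝ) ^ 2 * g * (u ⬝ᵥ u) := fun u => by
    have h1 := hA.gramian_mono (S := S) (T := (2 * (σ : ℝ) ^ 2) • 1)
      (fun u => by rw [quad_smul, hone]; exact hSb u) u
    rw [gramian_smul, gramian_one, quad_smul] at h1
    have h2 := mul_le_mul_of_nonneg_left (hΓg u) (by positivity : 0 ≤ 2 * (σ : ℝ) ^ 2)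
    linarith
  have hG1 : ∀ u, u ⬝ᵥ u ≤ quad (gramian A S) u := fun u => (hΓ1 u).trans (hΓG u)
  -- Only linear growth in `g` is needed: `g ≤ g³ / λ_min` because `λ_min ≤ g` and `g ≥ 1`.
  have hburn' : 9830400 * ((σ : ℝ) ^ 4 * g * (6 * L)) ≤ n := by
    refine le_trans ?_ hburn
    have h1 : g ≤ g ^ 3 / minEig (gramianInf_isHermitian A) := by
      rw [le_div_iff₀ (by linarith)]
      calc g * minEig (gramianInf_isHermitian A) ≤ g * g := by gcongr
        _ ≤ g ^ 3 := by nlinarith [mul_nonneg (by linarith : 0 ≤ g) (by linarith : 0 ≤ g)]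
    calc 9830400 * ((σ : ℝ) ^ 4 * g * (6 * L)) = 58982400 * (σ : ℝ) ^ 4 * g * L := by ring
      _ ≤ 58982400 * (σ : ℝ) ^ 4 * (g ^ 3 / minEig (gramianInf_isHermitian A)) * L := by gcongr
      _ = _ := by ring
  have hK1 : 9830400 * ((σ : ℝ) ^ 4 * (6 * L)) ≤ n := by
    refine le_trans ?_ hburn'
    gcongr
    exact le_mul_of_one_le_right (by positivity) hg1
  have hn : 0 < n := by
    have : (0 : ℝ) < n := lt_of_lt_of_le (by positivity) hK1
    exact_mod_cast this
  have hn' : (0 : ℝ) < n := by exact_mod_cast hn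
  obtain ⟨N, hc, hN⟩ := exists_isFormNet hSh hS1
  obtain ⟨N₁, hc₁, hN₁⟩ := exists_isFormNet (M := (1 : Matrix (Fin d) (Fin d) ℝ))
    Matrix.isHermitian_one fun u => (hone u).ge
  obtain ⟨N₂, hc₂, hN₂⟩ := exists_isFormNet (gramian_isHermitian A hSh) hG1
  have hbad := measure_not_good_event_le (n := n) (K := 6 * L) hA hind hη hsub hS hS1 hb
    (by positivity) hK1 (by linarith) hΓg hN hN₁ hc hc₁ hc₂
    (1 / (20 * ((2 * (σ : ℝ) ^ 2) ^ 2 * g))) (√(6 * L / (n * (σ : ℝ) ^ 2)))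
  refine (measure_mono fun ω hω => ?_).trans
    (hbad.trans (ENNReal.ofReal_le_ofReal (card_mul_exp_le hd hδ0 hδ1)))
  intro hgood
  refine hω ?_
  obtain ⟨hgood₁, hgood₂, hgood₃, hgood₄⟩ := hgood
  obtain ⟨B, hB, hBhat⟩ := hest ω
  have hbounds := empirical_covariance_bounds (w := fun i => η i ω) (K := 6 * L) hA hSh hS1 hGg hN
    hb (by linarith) hn (by positivity) (by
      refine le_trans ?_ hburn'
      have : 0 ≤ (σ : ℝ) ^ 4 * g * (6 * L) := by positivity
      calc _ = 6400 * ((σ : ℝ) ^ 4 * g * (6 * L)) := by ring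
        _ ≤ _ := by linarith) hgood₁
    (by rwa [show 2 * (σ : ℝ) ^ 2 / 2 = (σ : ℝ) ^ 2 by ring]) hgood₃
  have hcorr := noise_state_correlation_le (w := fun i => η i ω) hN₁ hN₂ (pow_pos hσ' 2) hn
    (by positivity) (fun u => (hbounds u).2) hgood₄
  have herr := hB.quad_error_le hn (fun u => (dotProduct_self_nonneg' u).trans (hG1 u))
    (fun u => (hbounds u).1) (by positivity) hcorr
  have hfinal := hBhat.frobNorm_sub_sq_le h1r hr (gramianInf_isHermitian A) hΓ1 hrank
    -- The error is controlled in the norm of `G`; it passes to `Γ ⪯ G`, so the harmonic mean is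
    -- that of `gramianInf A`.
    fun p hp => (hΓG _).trans (herr p hp)
  refine hfinal.trans (le_of_eq ?_)
  rw [mul_pow, Real.sq_sqrt (by positivity), div_mul_eq_div_div, div_eq_mul_inv (r : ℝ),
    div_eq_mul_inv _ (harmonicEig r _)]
  field_simp
  ring
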